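/- Let $m,n,p,q\ge 1$ and let a bilinear algorithm $\langle m,n,p\rangle=q$ (the base case) be given: it multiplies an $m\times n$ matrix $A$ by an $n\times p$ matrix $B$ with $q$ scalar multiplications of a linear form of the entries of $A$ by a linear form of the entries of $B$, and every entry of the product $C$ is a linear form of the $q$ products; coefficients are in a commutative ring, and the algorithm is either exact, or approximate in the sense of Bini (correct up to terms of order $\lambda$; more generally, up to an error with coefficients in a proper ideal of a subring of the ring of coefficients). The linear forms are computed by fixed straight-line programs of unary and binary linear operations. The encoding graph of $A$ (of $B$) has as vertices the entries of $A$ (of $B$) and the operations that compute the $q$ linear forms, each operation being joined to its operands; an output of the program (one of the $q$ linear forms) may be an input vertex. An encoding graph has no multiply-copied inputs if each input vertex occurs at most once as an output vertex. For $t\ge1$ consider the algorithm $\langle m^t,n^t,p^t\rangle=q^t$ obtained from the base case by $t$ levels of recursion on blocks, and its computation graph, whose vertices are the input entries and the arithmetic operations (copied entries being identified). On a machine with a fast memory of $M\ge1$ words and an unbounded slow memory, which holds the inputs at the beginning and must hold the outputs at the end, the operations are performed exactly once each, in any order compatible with the graph; an operation needs its operands in fast memory and puts its result there. Let $W$ be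 the minimal number of words moved between fast and slow memory. Suppose that one of the two encoding graphs of the base case is connected (as an undirected graph) and has no multiply-copied inputs, and let $N=mn$ (for $A$) or $N=np$ (for $B$) be the number of its inputs; assume $N>1$. Then there is a constant $c>0$, depending only on the base case, such that for all $t\ge 1$ and $M\ge 1$ $$W\ \ge\ c\,\frac{q^t}{t^{\log_N q}\,M^{\log_N q-1}} .$$ Further, if $N=\max\{mn,np,mp\}$ and $q>N$, this bound is tight up to the factor $t^{\log_N q}$ as long as $M=O(N^t)$: for every $\kappa>0$ there is a constant $C$, depending only on $\kappa$ and the base case, such that for all $t\ge1$ and all $M$ with $3\le M\le\kappa N^t$ $$W\ \le\ C\,t^{\log_N q}\cdot\frac{q^t}{t^{\log_N q}\,M^{\log_N q-1}} .$$ The factor is polylogarithmic in the input size: $t^{\log_N q}\le\bigl(\log_2((mn)^t+(np)^t)\bigr)^{\log_N q}$. -/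

import Mathlib

/-- A straight-line program that computes linear forms of the inputs `X`, one for each output
in `Y`.  Its vertices are the inputs `X` and the `size` arithmetic operations ("gates").
Gate `g` computes `a g • (left operand) + b g • (right operand)`, where each operand is an input
or an earlier gate; a gate with `left g = right g` is a unary operation (in-degree one).
An output may be any vertex, in particular it may be an input vertex. -/
structure LinCircuit (K : Type*) (X Y : Type) where
  size : ℕ
  left : (g : Fin size) → X ⊕ Fin g.val
  right : (g : Fin size) → X ⊕ Fin g.val
  a : Fin size → K
  b : Fin size → K
  out : Y → X ⊕ Fin size

namespace LinCircuit

variable {K : Type*} {X Y : Type} (c : LinCircuit K X Y)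

/-- A gate below gate `g`, seen as a gate of the whole circuit. -/
def lift {s : ℕ} (g : Fin s) (h : Fin g.val) : Fin s := ⟨h.val, h.isLt.trans g.isLt⟩

/-- The two operands of a gate, as vertices of the circuit. -/
def leftV (g : Fin c.size) : X ⊕ Fin c.size := (c.left g).map id (lift g)

/-- See `leftV`. -/
def rightV (g : Fin c.size) : X ⊕ Fin c.size := (c.right g).map id (lift g)

/-- The undirected graph of the circuit: inputs and gates, a gate being joined to its operands. -/
def graph : SimpleGraph (X ⊕ Fin c.size) :=
  SimpleGraph.fromRel fun u v => ∃ g, v = Sum.inr g ∧ (u = c.leftV g ∨ u = c.rightV g)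

/-- Every input vertex occurs at most once as an output vertex. -/
def NoMultiplyCopied : Prop :=
  ∀ (x : X) (r r' : Y), c.out r = Sum.inl x → c.out r' = Sum.inl x → r = r'

open Classical in
/-- The coefficient vector of the linear form computed by a gate. -/
noncomputable def gateForm [CommRing K] (g : Fin c.size) : X → K :=
  c.a g • (match c.left g with
    | Sum.inl x => Pi.single x 1
    | Sum.inr h => gateForm (lift g h)) +
  c.b g • (match c.right g with
    | Sum.inl x => Pi.single x 1
    | Sum.inr h => gateForm (lift g h))
termination_by g.val
decreasing_by all_goals exact h.isLt

open Classical in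
/-- The coefficient vector of the linear form at an output. -/
noncomputable def outForm [CommRing K] (r : Y) : X → K :=
  match c.out r with
  | Sum.inl x => Pi.single x 1
  | Sum.inr g => c.gateForm g

end LinCircuit

/-- The two input matrices. -/
inductive Operand
  | A
  | B

/-- The positions of the entries of an input matrix: `A` is `m × n` and `B` is `n × p`. -/
abbrev Operand.Idx (m n p : ℕ) : Operand → Type
  | .A => Fin m × Fin n
  | .B => Fin n × Fin p

/-- The number of entries of an input matrix. -/
def Operand.card (m n p : ℕ) : Operand → ℕ
  | .A => m * n
  | .B => n * p

/-- The shape of a bilinear algorithm with `q` scalar multiplications for an `m × n` times `n × p`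
matrix product: circuits for the encodings of `A` and `B` (linear forms of the entries of `A`,
and of `B`, one for each multiplication), and for the decoding of `C` (one linear form of the `q`
products for each entry of `C`). -/
structure BilinearAlgorithm (K : Type*) (m n p q : ℕ) where
  enc : (o : Operand) → LinCircuit K (o.Idx m n p) (Fin q)
  dec : LinCircuit K (Fin q) (Fin m × Fin p)

namespace BilinearAlgorithm

variable {K : Type*} {m n p q : ℕ} (alg : BilinearAlgorithm K m n p q)

/-- The coefficient of `A i j * B j' k` in the entry `C i' k'` that the algorithm computes. -/
noncomputable def tensor [CommRing K] (ij : Fin m × Fin n) (jk : Fin n × Fin p)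
    (ik : Fin m × Fin p) : K :=
  ∑ r : Fin q, alg.dec.outForm ik r * ((alg.enc .A).outForm r ij * (alg.enc .B).outForm r jk)

open Classical in
/-- The algorithm computes the matrix product up to an error whose coefficients lie in the ideal
`I` of the subring `O` of the ring of coefficients.  `I = ⊥` means that it is exact, and
approximate algorithms, which have coefficients in `F[λ, λ⁻¹]` and are correct up to terms of
order `λ`, are the case `O = F[λ]`, `I = (λ)`. -/
def MultipliesModulo [CommRing K] (O : Subring K) (I : Ideal O) : Prop :=
  ∀ (i : Fin m) (j j' : Fin n) (k : Fin p) (i' : Fin m) (k' : Fin p), ∃ e ∈ I,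
    alg.tensor (i, j) (j', k) (i', k') =
      (if i = i' ∧ j = j' ∧ k = k' then 1 else 0) + (e : K)

/-- The arithmetic operations of the `t`-level recursive algorithm.  With no level left there is
one scalar multiplication.  One level consists of a copy of each encoding circuit for each position
`x` inside a block, of `q` recursive calls, and of a copy of the decoding circuit for each
position `y` inside a block of `C`. -/
inductive Gate : ℕ → Type
  | mul : Gate 0
  | enc {t : ℕ} (o : Operand) (g : Fin (alg.enc o).size) (x : Fin t → o.Idx m n p) : Gate (t + 1)
  | call {t : ℕ} (r : Fin q) (g : Gate t) : Gate (t + 1)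
  | dec {t : ℕ} (g : Fin alg.dec.size) (y : Fin t → Fin m × Fin p) : Gate (t + 1)

/-- The input entries of the `t`-level algorithm; an entry of the `m ^ t × n ^ t` matrix `A` is
given by the sequence of its block positions, outermost first, and likewise for `B`. -/
abbrev Input (m n p t : ℕ) : Type := (o : Operand) × (Fin t → o.Idx m n p)

/-- The vertices of the computation graph: input entries and arithmetic operations. -/
abbrev Vertex (t : ℕ) : Type := Input m n p t ⊕ alg.Gate t

/-- The vertex of the encoding circuit of `o` in its copy number `x` on the outermost level. -/
def encV {t : ℕ} (o : Operand) (x : Fin t → o.Idx m n p) :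
    o.Idx m n p ⊕ Fin (alg.enc o).size → alg.Vertex (t + 1)
  | Sum.inl j => Sum.inl ⟨o, Fin.cons j x⟩
  | Sum.inr g => Sum.inr (.enc o g x)

/-- The vertices of the `r`-th recursive call.  The entry `x` of its input matrix is identified with
output `r` of the copy number `x` of the encoding circuit. -/
def callV {t : ℕ} (r : Fin q) : alg.Vertex t → alg.Vertex (t + 1)
  | Sum.inl ⟨o, x⟩ => alg.encV o x ((alg.enc o).out r)
  | Sum.inr g => Sum.inr (.call r g)

/-- The vertex that holds entry `y` of the product.  Input `r` of the copy number `y` of the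
decoding circuit is identified with entry `y` of the result of the `r`-th recursive call. -/
def outV : (t : ℕ) → (Fin t → Fin m × Fin p) → alg.Vertex t
  | 0, _ => Sum.inr .mul
  | t + 1, y =>
    match alg.dec.out (y 0) with
    | Sum.inl r => alg.callV r (outV t (Fin.tail y))
    | Sum.inr g => Sum.inr (.dec g (Fin.tail y))

/-- The vertex of the decoding circuit in its copy number `y` on the outermost level. -/
def decV {t : ℕ} (y : Fin t → Fin m × Fin p) :
    Fin q ⊕ Fin alg.dec.size → alg.Vertex (t + 1)
  | Sum.inl r => alg.callV r (alg.outV t y)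
  | Sum.inr g => Sum.inr (.dec g y)

/-- The left operand of an arithmetic operation. -/
def leftV : {t : ℕ} → alg.Gate t → alg.Vertex t
  | _, .mul => Sum.inl ⟨.A, Fin.elim0⟩
  | _, .enc o g x => alg.encV o x ((alg.enc o).leftV g)
  | _, .call r g => alg.callV r (leftV g)
  | _, .dec g y => alg.decV y (alg.dec.leftV g)

/-- The right operand of an arithmetic operation. -/
def rightV : {t : ℕ} → alg.Gate t → alg.Vertex t
  | _, .mul => Sum.inl ⟨.B, Fin.elim0⟩
  | _, .enc o g x => alg.encV o x ((alg.enc o).rightV g)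
  | _, .call r g => alg.callV r (rightV g)
  | _, .dec g y => alg.decV y (alg.dec.rightV g)

end BilinearAlgorithm

/-- A computation graph with (at most) binary operations: vertices are inputs and operations, and
there is an edge to each operation from its operands. -/
structure CDAG where
  Input : Type
  Gate : Type
  left : Gate → Input ⊕ Gate
  right : Gate → Input ⊕ Gate
  outputs : Set (Input ⊕ Gate)

/-- The computation graph of the `t`-level recursive algorithm. -/
def BilinearAlgorithm.cdag {K : Type*} {m n p q : ℕ} (alg : BilinearAlgorithm K m n p q)
    (t : ℕ) : CDAG where
  Input := BilinearAlgorithm.Input m n p t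
  Gate := alg.Gate t
  left := alg.leftV
  right := alg.rightV
  outputs := Set.range (alg.outV t)

namespace CDAG

/-- The contents of the fast and of the slow memory, and the operations performed so far. -/
structure State (G : CDAG) where
  fast : Set (G.Input ⊕ G.Gate)
  slow : Set (G.Input ⊕ G.Gate)
  done : Set G.Gate

/-- `G.Exec M s w`: state `s` can be reached with a fast memory of `M` words and `w` words moved
between fast and slow memory.  Initially the slow memory holds the inputs.  An operation
needs its operands in fast memory, puts its result there, and is performed at most once. -/
inductive Exec (G : CDAG) (M : ℕ) : G.State → ℕ → Prop
  | start : Exec G M ⟨∅, Set.range Sum.inl, ∅⟩ 0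
  | read {s : G.State} {w : ℕ} (v : G.Input ⊕ G.Gate) (hs : Exec G M s w) (hv : v ∈ s.slow)
      (hM : (insert v s.fast).encard ≤ M) :
      Exec G M ⟨insert v s.fast, s.slow, s.done⟩ (w + 1)
  | write {s : G.State} {w : ℕ} (v : G.Input ⊕ G.Gate) (hs : Exec G M s w) (hv : v ∈ s.fast) :
      Exec G M ⟨s.fast, insert v s.slow, s.done⟩ (w + 1)
  | discard {s : G.State} {w : ℕ} (v : G.Input ⊕ G.Gate) (hs : Exec G M s w) :
      Exec G M ⟨s.fast \ {v}, s.slow, s.done⟩ w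
  | compute {s : G.State} {w : ℕ} (g : G.Gate) (hs : Exec G M s w) (hg : g ∉ s.done)
      (hl : G.left g ∈ s.fast) (hr : G.right g ∈ s.fast)
      (hM : (insert (Sum.inr g) s.fast).encard ≤ M) :
      Exec G M ⟨insert (Sum.inr g) s.fast, s.slow, insert g s.done⟩ w

/-- With a fast memory of `M` words the computation can be carried out, in some order, with `w`
words moved: every operation is performed and the outputs end up in slow memory. -/
def HasCost (G : CDAG) (M w : ℕ) : Prop :=
  ∃ s : G.State, G.Exec M s w ∧ s.done = Set.univ ∧ G.outputs ⊆ s.slow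

end CDAG

/-! Lower bound. Cut the schedule into segments with `q ^ k` scalar multiplications each. Let `S` be
the operations of one segment. As nothing is recomputed, every vertex that carries a value into or
out of `S` is in fast memory at one of the two ends of the segment, or is read or written in
between, so there are at most `2 * M + w` such vertices (`encard_boundary_le`). It remains to see
that the encoding graphs of all levels, taken together, have many edges leaving or entering `S`.

This is edge expansion (`le_cutCount`): the number of pairs (multiplication, input entry) separated
by `S` is at most `N * q ^ t` times the number of cut operations. In the induction on levels, a
connected copy of the encoding circuit that is not cut lies entirely inside or outside `S`, so the
fraction of input entries in `S` passes to each recursive call with an error controlled by the cuts.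
The step also needs `N ≤ q`, which holds because the algorithm factors an identity matrix of size
`N` (modulo a proper ideal) through `q` products (`card_le`). A set with at most half of the `q ^ k`
multiplications of a `k`-level problem is thus cut in proportion to its size
(`mulCount_le_cutCount`).

Edges become vertices at the cost of the maximal degree. Copied entries are identified across
levels, but without multiply-copied inputs the degree is only `O(t)` (`encDegree_le`); this is the
origin of the factor `t ^ log_N q`. With `N ^ k` of order `t * M` every segment moves at least `M`
words. If the problem has too few levels for this, reading all inputs already costs enough.

Upper bound. Run the innermost `k` levels inside the fast memory, with `N ^ k` of order `M`, and
stream the operations of the outer levels one at a time. As `q > N`, the cost is dominated by the `q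
^ (t - k)` inner problems of size `N ^ k`. -/

namespace CDAG

/-! ### Memory traffic of a segment of a schedule -/

variable {G : CDAG} {M : ℕ}

/-- `u` is an operand of the operation `g`. -/
def IsOperand (G : CDAG) (u : G.Input ⊕ G.Gate) (g : G.Gate) : Prop :=
  u = G.left g ∨ u = G.right g

/-- `Reach G M x y w`: from state `x` one gets to state `y` with `w` words moved. -/
inductive Reach (G : CDAG) (M : ℕ) (x : G.State) : G.State → ℕ → Prop
  | refl : Reach G M x x 0
  | read {s : G.State} {w : ℕ} (v : G.Input ⊕ G.Gate) (hs : Reach G M x s w) (hv : v ∈ s.slow)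
      (hM : (insert v s.fast).encard ≤ M) :
      Reach G M x ⟨insert v s.fast, s.slow, s.done⟩ (w + 1)
  | write {s : G.State} {w : ℕ} (v : G.Input ⊕ G.Gate) (hs : Reach G M x s w) (hv : v ∈ s.fast) :
      Reach G M x ⟨s.fast, insert v s.slow, s.done⟩ (w + 1)
  | discard {s : G.State} {w : ℕ} (v : G.Input ⊕ G.Gate) (hs : Reach G M x s w) :
      Reach G M x ⟨s.fast \ {v}, s.slow, s.done⟩ w
  | compute {s : G.State} {w : ℕ} (g : G.Gate) (hs : Reach G M x s w) (hg : g ∉ s.done)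
      (hl : G.left g ∈ s.fast) (hr : G.right g ∈ s.fast)
      (hM : (insert (Sum.inr g) s.fast).encard ≤ M) :
      Reach G M x ⟨insert (Sum.inr g) s.fast, s.slow, insert g s.done⟩ w

theorem Reach.trans {x y z : G.State} {w w' : ℕ} (h : Reach G M x y w) (h' : Reach G M y z w') :
    Reach G M x z (w + w') := by
  induction h' with
  | refl => exact h
  | read v _ hv hM ih => exact ih.read v hv hM
  | write v _ hv ih => exact ih.write v hv
  | discard v _ ih => exact ih.discard v
  | compute g _ hg hl hr hM ih => exact ih.compute g hg hl hr hM

theorem Exec.reach {s : G.State} {w : ℕ} (h : G.Exec M s w) :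
    Reach G M ⟨∅, Set.range Sum.inl, ∅⟩ s w := by
  induction h with
  | start => exact .refl
  | read v _ hv hM ih => exact ih.read v hv hM
  | write v _ hv ih => exact ih.write v hv
  | discard v _ ih => exact ih.discard v
  | compute g _ hg hl hr hM ih => exact ih.compute g hg hl hr hM

theorem Exec.of_reach {x s : G.State} {w w' : ℕ} (hx : G.Exec M x w) (h : Reach G M x s w') :
    G.Exec M s (w + w') := by
  induction h with
  | refl => exact hx
  | read v _ hv hM ih => exact ih.read v hv hM
  | write v _ hv ih => exact ih.write v hv
  | discard v _ ih => exact ih.discard v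
  | compute g _ hg hl hr hM ih => exact ih.compute g hg hl hr hM

theorem Exec.encard_fast_le {s : G.State} {w : ℕ} (h : G.Exec M s w) : s.fast.encard ≤ M := by
  induction h with
  | start => simp
  | read v _ hv hM ih => exact hM
  | write v _ hv ih => exact ih
  | discard v _ ih => exact (Set.encard_le_encard Set.sdiff_subset).trans ih
  | compute g _ hg hl hr hM ih => exact hM

theorem Exec.mem_done {s : G.State} {w : ℕ} (h : G.Exec M s w) :
    ∀ g, Sum.inr g ∈ s.fast ∪ s.slow → g ∈ s.done := by
  induction h with
  | start => simp
  | read v _ hv hM ih =>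
    rintro g ((rfl | hg) | hg)
    · exact ih g (.inr hv)
    · exact ih g (.inl hg)
    · exact ih g (.inr hg)
  | write v _ hv ih =>
    rintro g (hg | (rfl | hg))
    · exact ih g (.inl hg)
    · exact ih g (.inl hv)
    · exact ih g (.inr hg)
  | discard v _ ih =>
    rintro g (hg | hg)
    · exact ih g (.inl hg.1)
    · exact ih g (.inr hg)
  | compute g _ hg hl hr hM ih =>
    rintro h ((hh | hh) | hh)
    · exact .inl (Sum.inr_injective hh)
    · exact .inr (ih h (.inl hh))
    · exact .inr (ih h (.inr hh))

theorem Exec.operand_mem_done {s : G.State} {w : ℕ} (h : G.Exec M s w) :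
    ∀ g ∈ s.done, ∀ h, G.IsOperand (Sum.inr h) g → h ∈ s.done := by
  induction h with
  | start => simp
  | read v _ hv hM ih => exact ih
  | write v _ hv ih => exact ih
  | discard v _ ih => exact ih
  | compute g hs hg hl hr hM ih =>
    rintro g' (rfl | hg') h hop
    · refine .inr (hs.mem_done h (.inl ?_))
      rcases hop with e | e <;> rw [e] <;> assumption
    · exact .inr (ih g' hg' h hop)

theorem Reach.done_subset {x y : G.State} {w : ℕ} (h : Reach G M x y w) : x.done ⊆ y.done := by
  induction h with
  | refl => exact subset_rfl
  | read v _ hv hM ih => exact ih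
  | write v _ hv ih => exact ih
  | discard v _ ih => exact ih
  | compute g _ hg hl hr hM ih => exact ih.trans (Set.subset_insert _ _)

/-- What is read and written between two states. -/
theorem Reach.traffic {x y : G.State} {w : ℕ} (h : Reach G M x y w) :
    ∃ R W : Set (G.Input ⊕ G.Gate), R.encard + W.encard ≤ w ∧
      y.fast ⊆ x.fast ∪ R ∪ Sum.inr '' (y.done \ x.done) ∧ y.slow ⊆ x.slow ∪ W ∧
      ∀ g ∈ y.done \ x.done, ∀ u, G.IsOperand u g →
        u ∈ x.fast ∪ R ∪ Sum.inr '' (y.done \ x.done) := by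
  induction h with
  | refl => exact ⟨∅, ∅, by simp, by simp, by simp, by simp⟩
  | read v _ hv hM ih =>
    obtain ⟨R, W, h1, h2, h3, h4⟩ := ih
    have hsub : ∀ D : Set (G.Input ⊕ G.Gate), x.fast ∪ R ∪ D ⊆ x.fast ∪ insert v R ∪ D := fun D =>
      Set.union_subset_union_left _ (Set.union_subset_union_right _ (Set.subset_insert _ _))
    refine ⟨insert v R, W, ?_, ?_, h3, fun g hg u hu => hsub _ (h4 g hg u hu)⟩
    · calc (insert v R).encard + W.encard ≤ (R.encard + 1) + W.encard := by
            gcongr; exact Set.encard_insert_le _ _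
        _ = R.encard + W.encard + 1 := by ring
        _ ≤ _ := by push_cast; gcongr
    · rintro u (rfl | hu)
      · exact .inl (.inr (.inl rfl))
      · exact hsub _ (h2 hu)
  | write v _ hv ih =>
    obtain ⟨R, W, h1, h2, h3, h4⟩ := ih
    refine ⟨R, insert v W, ?_, h2, ?_, h4⟩
    · calc R.encard + (insert v W).encard ≤ R.encard + (W.encard + 1) := by
            gcongr; exact Set.encard_insert_le _ _
        _ = R.encard + W.encard + 1 := by ring
        _ ≤ _ := by push_cast; gcongr
    · rintro u (rfl | hu)
      · exact .inr (.inl rfl)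
      · exact (h3 hu).imp id .inr
  | discard v _ ih =>
    obtain ⟨R, W, h1, h2, h3, h4⟩ := ih
    exact ⟨R, W, h1, Set.sdiff_subset.trans h2, h3, h4⟩
  | @compute s w g hs hg hl hr hM ih =>
    obtain ⟨R, W, h1, h2, h3, h4⟩ := ih
    have hsub : x.fast ∪ R ∪ Sum.inr '' (s.done \ x.done) ⊆
        x.fast ∪ R ∪ Sum.inr '' (insert g s.done \ x.done) :=
      Set.union_subset_union_right _
        (Set.image_mono (Set.sdiff_subset_sdiff_left (Set.subset_insert _ _)))
    refine ⟨R, W, h1, ?_, h3, ?_⟩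
    · rintro u (rfl | hu)
      · exact .inr ⟨g, ⟨.inl rfl, fun h => hg (hs.done_subset h)⟩, rfl⟩
      · exact hsub (h2 hu)
    · rintro g' ⟨rfl | hg', hx⟩ u hu
      · refine hsub (h2 ?_)
        rcases hu with e | e <;> rw [e] <;> assumption
      · exact hsub (h4 g' ⟨hg', hx⟩ u hu)

/-- Reads and writes only copy values between the memories, and a performed operation is not
repeated; a value that is in neither memory is lost for good. -/
theorem Reach.mem_of_done {y z : G.State} {w : ℕ} (h : Reach G M y z w) :
    ∀ h ∈ y.done, Sum.inr h ∈ z.fast ∪ z.slow → Sum.inr h ∈ y.fast ∪ y.slow := by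
  induction h with
  | refl => exact fun _ _ h => h
  | read v _ hv hM ih =>
    rintro h hh ((rfl | hg) | hg)
    · exact ih h hh (.inr hv)
    · exact ih h hh (.inl hg)
    · exact ih h hh (.inr hg)
  | write v _ hv ih =>
    rintro h hh (hg | (rfl | hg))
    · exact ih h hh (.inl hg)
    · exact ih h hh (.inl hv)
    · exact ih h hh (.inr hg)
  | discard v _ ih =>
    rintro h hh (hg | hg)
    · exact ih h hh (.inl hg.1)
    · exact ih h hh (.inr hg)
  | compute g hs hg hl hr hM ih =>
    rintro h hh ((e | hg') | hg')
    · cases Sum.inr_injective e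
      exact absurd (hs.done_subset hh) hg
    · exact ih h hh (.inl hg')
    · exact ih h hh (.inr hg')

theorem Reach.mem_of_operand {y z : G.State} {w : ℕ} (h : Reach G M y z w) :
    ∀ g ∈ z.done \ y.done, ∀ h ∈ y.done, G.IsOperand (Sum.inr h) g →
      Sum.inr h ∈ y.fast ∪ y.slow := by
  induction h with
  | refl => simp
  | read v _ hv hM ih => exact ih
  | write v _ hv ih => exact ih
  | discard v _ ih => exact ih
  | compute g hs hg hl hr hM ih =>
    rintro g' ⟨rfl | hg', hx⟩ h hh hop
    · refine hs.mem_of_done h hh (.inl ?_)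
      rcases hop with e | e <;> rw [e] <;> assumption
    · exact ih g' ⟨hg', hx⟩ h hh hop

/-- The vertices at the ends of edges between the operations in `S` and the other vertices, on the
operand side. -/
def boundary (G : CDAG) (S : Set G.Gate) : Set (G.Input ⊕ G.Gate) :=
  {u | ∃ g, G.IsOperand u g ∧ ¬ (u ∈ Sum.inr '' S ↔ g ∈ S)}

/-- The boundary of the operations that are performed between two states is small unless many words
are moved. -/
theorem encard_boundary_le {x y z : G.State} {w₀ w w' : ℕ} (hx : G.Exec M x w₀)
    (hxy : Reach G M x y w) (hyz : Reach G M y z w') (hz : z.done = Set.univ) :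
    (G.boundary (y.done \ x.done)).encard ≤ 2 * M + w := by
  obtain ⟨R, W, h1, h2, h3, h4⟩ := hxy.traffic
  -- A value from outside used in the segment was in fast memory at its start or is read. A value of
  -- the segment used outside is used later, since earlier operations had all their operands done;
  -- so it is in fast memory at the end or is written.
  have hsub : G.boundary (y.done \ x.done) ⊆ (x.fast ∪ y.fast) ∪ (R ∪ W) := by
    rintro u ⟨g, hop, hne⟩
    by_cases hg : g ∈ y.done \ x.done
    · have hu : u ∉ Sum.inr '' (y.done \ x.done) := fun hu => hne ⟨fun _ => hg, fun _ => hu⟩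
      rcases h4 g hg u hop with (h | h) | h
      · exact .inl (.inl h)
      · exact .inr (.inl h)
      · exact absurd h hu
    · have hu : u ∈ Sum.inr '' (y.done \ x.done) := by
        by_contra hu
        exact hne ⟨fun h => absurd h hu, fun h => absurd h hg⟩
      obtain ⟨h, ⟨hhy, hhx⟩, rfl⟩ := hu
      have hgx : g ∉ x.done := fun hgx => hhx (hx.operand_mem_done g hgx h hop)
      have hgy : g ∉ y.done := fun hgy => hg ⟨hgy, hgx⟩
      rcases hyz.mem_of_operand g ⟨hz ▸ Set.mem_univ g, hgy⟩ h hhy hop with h' | h'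
      · exact .inl (.inr h')
      · rcases h3 h' with h' | h'
        · exact absurd (hx.mem_done h (.inr h')) hhx
        · exact .inr (.inr h')
  calc (G.boundary (y.done \ x.done)).encard
      ≤ ((x.fast ∪ y.fast) ∪ (R ∪ W)).encard := Set.encard_le_encard hsub
    _ ≤ (x.fast.encard + y.fast.encard) + (R.encard + W.encard) :=
        (Set.encard_union_le _ _).trans
          (add_le_add (Set.encard_union_le _ _) (Set.encard_union_le _ _))
    _ ≤ (M + M) + w := by
        gcongr
        · exact hx.encard_fast_le
        · exact (hx.of_reach hxy).encard_fast_le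
    _ = 2 * M + w := by ring

/-- An input that is an operand has to be read. -/
theorem HasCost.encard_le {w : ℕ} (h : G.HasCost M w) (T : Set G.Input)
    (hT : ∀ v ∈ T, ∃ g, G.IsOperand (Sum.inl v) g) : T.encard ≤ w := by
  obtain ⟨s, hs, hd, -⟩ := h
  obtain ⟨R, W, h1, -, -, h4⟩ := hs.reach.traffic
  have hsub : Sum.inl '' T ⊆ R := by
    rintro _ ⟨v, hv, rfl⟩
    obtain ⟨g, hg⟩ := hT v hv
    rcases h4 g ⟨hd ▸ Set.mem_univ g, by simp⟩ _ hg with (h | h) | h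
    · exact absurd h (by simp)
    · exact h
    · simp at h
  calc T.encard = (Sum.inl '' T : Set (G.Input ⊕ G.Gate)).encard :=
        (Sum.inl_injective.encard_image T).symm
    _ ≤ R.encard := Set.encard_le_encard hsub
    _ ≤ R.encard + W.encard := le_self_add
    _ ≤ w := h1

/-- A quantity that grows by at most one with each operation takes all intermediate values. -/
theorem Exec.exists_intermediate (f : Set G.Gate → ℕ) (h0 : f ∅ = 0)
    (hf : ∀ S g, f (insert g S) ≤ f S + 1) {y : G.State} {w : ℕ} (h : G.Exec M y w) :
    ∀ v ≤ f y.done, ∃ x w₁ w₂, G.Exec M x w₁ ∧ Reach G M x y w₂ ∧ w = w₁ + w₂ ∧ f x.done = v := by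
  induction h with
  | start => exact fun v hv => ⟨_, 0, 0, .start, .refl, rfl, by simp_all⟩
  | read u _ hu hM ih =>
    intro v hv
    obtain ⟨x, w₁, w₂, h1, h2, rfl, h4⟩ := ih v hv
    exact ⟨x, w₁, w₂ + 1, h1, h2.read u hu hM, rfl, h4⟩
  | write u _ hu ih =>
    intro v hv
    obtain ⟨x, w₁, w₂, h1, h2, rfl, h4⟩ := ih v hv
    exact ⟨x, w₁, w₂ + 1, h1, h2.write u hu, rfl, h4⟩
  | discard u _ ih =>
    intro v hv
    obtain ⟨x, w₁, w₂, h1, h2, rfl, h4⟩ := ih v hv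
    exact ⟨x, w₁, w₂, h1, h2.discard u, rfl, h4⟩
  | @compute s w g hs hg hl hr hM ih =>
    intro v hv
    by_cases hvs : v ≤ f s.done
    · obtain ⟨x, w₁, w₂, h1, h2, rfl, h4⟩ := ih v hvs
      exact ⟨x, w₁, w₂, h1, h2.compute g hg hl hr hM, rfl, h4⟩
    · refine ⟨_, w, 0, hs.compute g hg hl hr hM, .refl, rfl, ?_⟩
      have := hf s.done g
      dsimp only at hv ⊢
      omega

/-- If moving at least `c` words is necessary whenever `f` grows by `P`, then `l * c` words are
necessary for `f` to reach `l * P`. -/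
theorem Exec.mul_le (f : Set G.Gate → ℕ) (h0 : f ∅ = 0) (hf : ∀ S g, f (insert g S) ≤ f S + 1)
    {P c : ℕ} {z : G.State}
    (hseg : ∀ x y w₀ w w', G.Exec M x w₀ → Reach G M x y w → Reach G M y z w' →
      f y.done = f x.done + P → c ≤ w)
    (l : ℕ) : ∀ y w w', G.Exec M y w → Reach G M y z w' → l * P ≤ f y.done → l * c ≤ w := by
  induction l with
  | zero => simp
  | succ l ih =>
    intro y w w' hy hyz hl
    rw [add_one_mul] at hl
    -- The last segment, in which `f` grows by exactly `P`, is split off.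
    obtain ⟨x, w₁, w₂, h1, h2, rfl, h4⟩ := hy.exists_intermediate f h0 hf (f y.done - P) (by omega)
    have := hseg x y w₁ w₂ w' h1 h2 hyz (by omega)
    have := ih x w₁ _ h1 (h2.trans hyz) (by omega)
    rw [add_one_mul]
    omega

end CDAG

/-! ### Counting operations, and vertex degrees in the encoding graphs -/

instance : Fintype Operand := ⟨⟨{Operand.A, Operand.B}, by simp⟩, fun o => by cases o <;> simp⟩

instance {m n p : ℕ} : (o : Operand) → Fintype (o.Idx m n p)
  | .A => inferInstanceAs (Fintype (Fin m × Fin n))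
  | .B => inferInstanceAs (Fintype (Fin n × Fin p))

theorem Operand.card_idx (m n p : ℕ) (o : Operand) : Fintype.card (o.Idx m n p) = o.card m n p := by
  cases o
  · exact (Fintype.card_prod (Fin m) (Fin n)).trans (by simp [Operand.card])
  · exact (Fintype.card_prod (Fin n) (Fin p)).trans (by simp [Operand.card])

namespace BilinearAlgorithm

variable {K : Type*} {m n p q : ℕ} (alg : BilinearAlgorithm K m n p q)

/-- The operations of the outermost encodings. -/
abbrev EncGate (t : ℕ) : Type :=
  (o : Operand) × Fin (alg.enc o).size × (Fin t → o.Idx m n p)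

/-- The operations of the outermost decodings. -/
abbrev DecGate (t : ℕ) : Type := Fin alg.dec.size × (Fin t → Fin m × Fin p)

/-- The operations of one level of recursion. -/
def gateSuccEquiv (t : ℕ) :
    alg.EncGate t ⊕ (Fin q × alg.Gate t) ⊕ alg.DecGate t ≃ alg.Gate (t + 1) where
  toFun
    | .inl e => .enc e.1 e.2.1 e.2.2
    | .inr (.inl e) => .call e.1 e.2
    | .inr (.inr e) => .dec e.1 e.2
  invFun
    | .enc o g x => .inl ⟨o, g, x⟩
    | .call r g => .inr (.inl (r, g))
    | .dec g y => .inr (.inr (g, y))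
  left_inv e := by rcases e with e | e | e <;> rfl
  right_inv g := by cases g <;> rfl

/-- There is one operation if no level of recursion is left. -/
def gateZeroEquiv : Unit ≃ alg.Gate 0 where
  toFun _ := .mul
  invFun _ := ()
  left_inv _ := rfl
  right_inv g := by cases g; rfl

noncomputable instance instFintypeGate : (t : ℕ) → Fintype (alg.Gate t)
  | 0 => Fintype.ofEquiv _ alg.gateZeroEquiv
  | t + 1 =>
    haveI := instFintypeGate t
    Fintype.ofEquiv _ (alg.gateSuccEquiv t)

theorem sum_gate_zero (f : alg.Gate 0 → ℕ) : ∑ g, f g = f .mul := by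
  rw [← alg.gateZeroEquiv.sum_comp]
  simp [gateZeroEquiv]

theorem sum_gate_succ {t : ℕ} (f : alg.Gate (t + 1) → ℕ) :
    ∑ g, f g = (∑ o, ∑ g, ∑ x, f (.enc o g x)) + (∑ r, ∑ g, f (.call r g)) +
      ∑ g, ∑ y, f (.dec g y) := by
  rw [← (alg.gateSuccEquiv t).sum_comp, Fintype.sum_sum_type, Fintype.sum_sum_type, ← add_assoc,
    Fintype.sum_sigma, Fintype.sum_prod_type, Fintype.sum_prod_type]
  simp only [Fintype.sum_prod_type, gateSuccEquiv, Equiv.coe_fn_mk]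

/-- The scalar multiplications. -/
def IsMul : {t : ℕ} → alg.Gate t → Prop
  | _, .mul => True
  | _, .enc .. => False
  | _, .call _ g => IsMul g
  | _, .dec .. => False

/-- The edges of the encoding graphs of `o` on all levels, together with those that join the
multiplications to their operand on the side of `o`. -/
def IsEncOperand (o : Operand) : {t : ℕ} → alg.Gate t → alg.Vertex t → Prop
  | _, .mul, u => u = Sum.inl ⟨o, Fin.elim0⟩
  | _, .enc o' g x, u => o' = o ∧
      (u = alg.encV o' x ((alg.enc o').leftV g) ∨ u = alg.encV o' x ((alg.enc o').rightV g))
  | _, .call r g, u => ∃ v, IsEncOperand o g v ∧ u = alg.callV r v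
  | _, .dec .., _ => False

theorem IsEncOperand.isOperand {o : Operand} : {t : ℕ} → {g : alg.Gate t} → {u : alg.Vertex t} →
    alg.IsEncOperand o g u → (alg.cdag t).IsOperand u g
  | _, .mul, u, h => by
    cases o
    · exact .inl h
    · exact .inr h
  | _, .enc _ _ _, _, h => h.2
  | _, .call r g, _, h => by
    obtain ⟨v, hv, rfl⟩ := h
    exact (IsEncOperand.isOperand hv).imp (congrArg (alg.callV r)) (congrArg (alg.callV r))

theorem encV_inj_right {t : ℕ} {o : Operand} {x y : Fin t → o.Idx m n p}
    {v w : o.Idx m n p ⊕ Fin (alg.enc o).size} (h : alg.encV o x v = alg.encV o y w) :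
    x = y ∧ v = w := by
  rcases v with v | v <;> rcases w with w | w <;> simp [encV] at h ⊢
  all_goals exact And.symm h

theorem encV_inj_left {t : ℕ} {o o' : Operand} {x : Fin t → o.Idx m n p} {y : Fin t → o'.Idx m n p}
    {v : o.Idx m n p ⊕ Fin (alg.enc o).size} {w : o'.Idx m n p ⊕ Fin (alg.enc o').size}
    (h : alg.encV o x v = alg.encV o' y w) : o = o' := by
  rcases v with v | v <;> rcases w with w | w <;> simp [encV] at h <;> exact h.1

theorem encV_ne_call {t : ℕ} {o : Operand} {x : Fin t → o.Idx m n p}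
    {v : o.Idx m n p ⊕ Fin (alg.enc o).size} {r : Fin q} {g : alg.Gate t} :
    alg.encV o x v ≠ Sum.inr (.call r g) := by
  rcases v with v | v <;> simp [encV]

theorem encV_ne_dec {t : ℕ} {o : Operand} {x : Fin t → o.Idx m n p}
    {v : o.Idx m n p ⊕ Fin (alg.enc o).size} {g : Fin alg.dec.size} {y : Fin t → Fin m × Fin p} :
    alg.encV o x v ≠ Sum.inr (.dec g y) := by
  rcases v with v | v <;> simp [encV]

/-- A recursive call meets the outermost encodings only where its inputs are identified with their
outputs. -/
theorem callV_eq_encV {t : ℕ} {o : Operand} {x : Fin t → o.Idx m n p}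
    {v : o.Idx m n p ⊕ Fin (alg.enc o).size} {r : Fin q} {w : alg.Vertex t}
    (h : alg.callV r w = alg.encV o x v) : w = Sum.inl ⟨o, x⟩ ∧ (alg.enc o).out r = v := by
  rcases w with ⟨o', x'⟩ | g
  · obtain rfl := alg.encV_inj_left h
    obtain ⟨h1, h2⟩ := alg.encV_inj_right h
    exact ⟨by rw [h1], h2⟩
  · rcases v with v | v <;> simp [callV, encV] at h

theorem isEncOperand_inl {o o' : Operand} : {t : ℕ} → {g : alg.Gate t} →
    {x : Fin t → o'.Idx m n p} → alg.IsEncOperand o g (Sum.inl ⟨o', x⟩) → o' = o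
  | _, .mul, _, h => by
    simp [IsEncOperand] at h
    exact h.1
  | _, .enc o'' g y, x, h => by
    obtain ⟨rfl, h⟩ := h
    have e : (Sum.inl ⟨o', x⟩ : alg.Vertex _) = alg.encV o' (Fin.tail x) (Sum.inl (x 0)) := by
      simp [encV]
    rw [e] at h
    rcases h with h | h <;> exact alg.encV_inj_left h
  | _, .call r g, x, h => by
    obtain ⟨v, hv, e⟩ := h
    have e' : alg.callV r v = alg.encV o' (Fin.tail x) (Sum.inl (x 0)) := by
      rw [← e]; simp [encV]
    obtain ⟨rfl, -⟩ := alg.callV_eq_encV e'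
    exact isEncOperand_inl hv

open Classical in
/-- The number of operations that have `u` as an operand in `IsEncOperand o`. -/
noncomputable def encDegree (o : Operand) {t : ℕ} (u : alg.Vertex t) : ℕ :=
  ∑ g : alg.Gate t, if alg.IsEncOperand o g u then 1 else 0

open Classical in
theorem encDegree_succ (o : Operand) {t : ℕ} (u : alg.Vertex (t + 1)) :
    alg.encDegree o u = (∑ g, ∑ x, if u = alg.encV o x ((alg.enc o).leftV g) ∨
        u = alg.encV o x ((alg.enc o).rightV g) then 1 else 0) +
      ∑ r, ∑ g, if ∃ v, alg.IsEncOperand o g v ∧ u = alg.callV r v then 1 else 0 := by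
  rw [encDegree, sum_gate_succ]
  have h0 : (∑ g, ∑ y, if alg.IsEncOperand o (Gate.dec g y : alg.Gate (t + 1)) u then 1 else 0) = 0 :=
    Finset.sum_eq_zero fun g _ => Finset.sum_eq_zero fun y _ => if_neg fun h => h
  rw [h0, add_zero]
  have h1 : (∑ r, ∑ g, if alg.IsEncOperand o (Gate.call r g : alg.Gate (t + 1)) u then 1 else 0) =
      ∑ r, ∑ g, if ∃ v, alg.IsEncOperand o g v ∧ u = alg.callV r v then 1 else 0 :=
    Finset.sum_congr rfl fun r _ => Finset.sum_congr rfl fun g _ =>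
      if_congr (by rw [IsEncOperand]) rfl rfl
  rw [h1, add_left_inj]
  rw [Finset.sum_eq_single_of_mem o (Finset.mem_univ o)]
  · simp [IsEncOperand]
  · intro o' _ ho'
    simp [IsEncOperand, ho']

-- An edge from vertex `v` of copy `x` leads either to a gate of the same copy, or into a call `r`
-- for which `v` is output `r`; inside that call the vertex is the input entry `x`.
open Classical in
theorem encDegree_succ_le (o : Operand) {t : ℕ} (x : Fin t → o.Idx m n p)
    (v : o.Idx m n p ⊕ Fin (alg.enc o).size) :
    alg.encDegree o (alg.encV o x v) ≤ (alg.enc o).size +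
      (∑ r, if (alg.enc o).out r = v then 1 else 0) *
        alg.encDegree o (Sum.inl ⟨o, x⟩ : alg.Vertex t) := by
  rw [encDegree_succ]
  gcongr
  · calc _ ≤ ∑ g : Fin (alg.enc o).size, ∑ y : Fin t → o.Idx m n p, if y = x then 1 else 0 := by
          gcongr with g _ y _
          split_ifs with h1 h2
          · exact le_rfl
          · rcases h1 with h1 | h1 <;> exact absurd (alg.encV_inj_right h1).1.symm h2
          · exact zero_le_one
          · exact le_rfl
      _ = _ := by simp
  · rw [Finset.sum_mul]
    gcongr with r _
    rw [encDegree, Finset.mul_sum]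
    gcongr with g _
    by_cases h1 : ∃ w, alg.IsEncOperand o g w ∧ alg.encV o x v = alg.callV r w
    · obtain ⟨w, hw, e⟩ := id h1
      obtain ⟨rfl, h2⟩ := alg.callV_eq_encV e.symm
      rw [if_pos h1, if_pos h2, if_pos hw]
      norm_num
    · rw [if_neg h1]
      exact Nat.zero_le _

/-- An input entry is handed on unchanged to at most one recursive call, so each level adds at most
the gates of one circuit. With multiple copies the degree could grow exponentially in `t`. -/
theorem encDegree_inl_le {o : Operand} (hcopy : (alg.enc o).NoMultiplyCopied) :
    {t : ℕ} → (x : Fin t → o.Idx m n p) →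
    alg.encDegree o (Sum.inl ⟨o, x⟩ : alg.Vertex t) ≤ (alg.enc o).size * t + 1
  | 0, x => by
    rw [encDegree, sum_gate_zero]
    split_ifs <;> simp
  | t + 1, x => by
    classical
    have h := alg.encDegree_succ_le o (Fin.tail x) (Sum.inl (x 0))
    have e : alg.encV o (Fin.tail x) (Sum.inl (x 0)) = Sum.inl ⟨o, x⟩ := by simp [encV]
    rw [e] at h
    have h1 : (∑ r, if (alg.enc o).out r = Sum.inl (x 0) then 1 else 0) ≤ 1 := by
      rw [Finset.sum_boole, Nat.cast_id, Finset.card_le_one]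
      intro r hr r' hr'
      exact hcopy _ r r' (by simpa using hr) (by simpa using hr')
    have h2 := encDegree_inl_le hcopy (Fin.tail x)
    calc _ ≤ _ := h
      _ ≤ (alg.enc o).size + 1 * ((alg.enc o).size * t + 1) := by gcongr
      _ = _ := by ring

/-- An encoding gate may serve as up to `q` outputs, but only on its own level; in each of these
calls it is an input entry. The factor `q + 1` instead of `q` lets the same bound cover input
vertices for every `q`. -/
theorem encDegree_le {o : Operand} (hcopy : (alg.enc o).NoMultiplyCopied) :
    {t : ℕ} → (u : alg.Vertex t) →
    alg.encDegree o u ≤ (alg.enc o).size + (q + 1) * ((alg.enc o).size * t + 1)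
  | t, Sum.inl ⟨o', x⟩ => by
    by_cases ho : o' = o
    · subst ho
      refine (alg.encDegree_inl_le hcopy x).trans ?_
      nlinarith [Nat.zero_le (q * ((alg.enc o').size * t + 1))]
    · have : alg.encDegree o (Sum.inl ⟨o', x⟩ : alg.Vertex t) = 0 := by
        refine Finset.sum_eq_zero fun g _ => if_neg fun h => ho (alg.isEncOperand_inl h)
      rw [this]; exact Nat.zero_le _
  | _, Sum.inr .mul => by
    rw [encDegree, sum_gate_zero]
    split_ifs with h
    · simp [IsEncOperand] at h
    · exact Nat.zero_le _
  | _, Sum.inr (.enc (t := t) o' g x) => by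
    classical
    by_cases ho : o' = o
    · subst ho
      have h := alg.encDegree_succ_le o' x (Sum.inr g)
      have h1 : (∑ r, if (alg.enc o').out r = Sum.inr g then 1 else 0) ≤ q := by
        rw [Finset.sum_boole, Nat.cast_id]
        exact (Finset.card_le_univ _).trans (by simp)
      have h2 := alg.encDegree_inl_le hcopy x
      calc _ ≤ _ := h
        _ ≤ (alg.enc o').size + (q + 1) * ((alg.enc o').size * (t + 1) + 1) := by
          gcongr
          · omega
          · exact h2.trans (by gcongr; omega)
    · rw [encDegree_succ, Finset.sum_eq_zero, Finset.sum_eq_zero]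
      · exact Nat.zero_le _
      · refine fun r _ => Finset.sum_eq_zero fun g' _ => if_neg ?_
        rintro ⟨v, hv, e⟩
        obtain ⟨rfl, -⟩ := alg.callV_eq_encV (v := Sum.inr g) e.symm
        exact ho (alg.isEncOperand_inl hv)
      · refine fun g' _ => Finset.sum_eq_zero fun y _ => if_neg ?_
        have e : (Sum.inr (.enc o' g x) : alg.Vertex (t + 1)) = alg.encV o' x (Sum.inr g) := rfl
        rw [e]
        rintro (h | h) <;> exact ho (alg.encV_inj_left h)
  | _, Sum.inr (.call (t := t) r g) => by
    classical
    have h := encDegree_le hcopy (Sum.inr g)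
    calc alg.encDegree o (Sum.inr (.call r g) : alg.Vertex (t + 1))
        ≤ 0 + ∑ r', if r' = r then alg.encDegree o (Sum.inr g : alg.Vertex t) else 0 := by
          rw [encDegree_succ]
          gcongr with r' _
          · refine (Finset.sum_eq_zero fun g' _ => Finset.sum_eq_zero fun y _ => if_neg ?_).le
            rintro (h | h) <;> exact alg.encV_ne_call h.symm
          · have key : ∀ v : alg.Vertex t, Sum.inr (.call r g) = alg.callV r' v →
                r' = r ∧ v = Sum.inr g := by
              rintro (⟨o', x⟩ | v) e
              · exact absurd e.symm alg.encV_ne_call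
              · simp only [callV, Sum.inr.injEq, Gate.call.injEq] at e
                exact ⟨e.1.symm, by rw [e.2]⟩
            split_ifs with hr
            · refine Finset.sum_le_sum fun g' _ => ?_
              split_ifs with h1 h2
              · exact le_rfl
              · obtain ⟨v, hv, e⟩ := h1
                exact absurd ((key v e).2 ▸ hv) h2
              · exact zero_le_one
              · exact le_rfl
            · refine (Finset.sum_eq_zero fun g' _ => if_neg ?_).le
              rintro ⟨v, hv, e⟩
              exact hr (key v e).1
      _ = alg.encDegree o (Sum.inr g : alg.Vertex t) := by simp
      _ ≤ _ := h
      _ ≤ _ := by gcongr; omega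
  | _, Sum.inr (.dec (t := t) g y) => by
    rw [encDegree_succ, Finset.sum_eq_zero, Finset.sum_eq_zero]
    · exact Nat.zero_le _
    · refine fun r _ => Finset.sum_eq_zero fun g' _ => if_neg ?_
      rintro ⟨v | v, hv, e⟩
      · exact alg.encV_ne_dec e.symm
      · simp [callV] at e
    · refine fun g' _ => Finset.sum_eq_zero fun y _ => if_neg ?_
      rintro (h | h) <;> exact alg.encV_ne_dec h.symm

end BilinearAlgorithm

/-! ### Edge expansion of the encoding graphs -/

/-- A connected graph has an edge that leaves a given set of vertices unless the set is empty or
contains all vertices. -/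
theorem SimpleGraph.Connected.mem_iff_mem {V : Type*} {G : SimpleGraph V} (hG : G.Connected)
    {S : Set V} (hS : ∀ u v, G.Adj u v → (u ∈ S ↔ v ∈ S)) (u v : V) : u ∈ S ↔ v ∈ S := by
  obtain ⟨w⟩ := hG.preconnected u v
  induction w with
  | nil => rfl
  | cons h _ ih => exact (hS _ _ h).trans ih

namespace LinCircuit

variable {K : Type*} {X Y : Type} (c : LinCircuit K X Y)

theorem mem_iff_mem (hc : c.graph.Connected) {S : Set (X ⊕ Fin c.size)}
    (hS : ∀ g, (c.leftV g ∈ S ↔ Sum.inr g ∈ S) ∧ (c.rightV g ∈ S ↔ Sum.inr g ∈ S))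
    (u v : X ⊕ Fin c.size) : u ∈ S ↔ v ∈ S := by
  refine hc.mem_iff_mem (fun u v h => ?_) u v
  rw [graph, SimpleGraph.fromRel_adj] at h
  rcases h with ⟨-, ⟨g, rfl, rfl | rfl⟩ | ⟨g, rfl, rfl | rfl⟩⟩
  · exact (hS g).1
  · exact (hS g).2
  · exact (hS g).1.symm
  · exact (hS g).2.symm

theorem exists_operand (hc : c.graph.Connected) [Nontrivial X] (x : X) :
    ∃ g, c.leftV g = Sum.inl x ∨ c.rightV g = Sum.inl x := by
  by_contra! h
  obtain ⟨y, hy⟩ := exists_ne x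
  refine hy (Sum.inl_injective ((c.mem_iff_mem hc (S := {Sum.inl x}) (fun g => ?_)
    (Sum.inl x) (Sum.inl y)).1 rfl))
  simp [h g]

end LinCircuit

namespace BilinearAlgorithm

variable {K : Type*} {m n p q : ℕ} (alg : BilinearAlgorithm K m n p q)

open Classical in
/-- The number of multiplications in `S`. -/
noncomputable def mulCount {t : ℕ} (S : Set (alg.Vertex t)) : ℕ :=
  ∑ g : alg.Gate t, if alg.IsMul g ∧ Sum.inr g ∈ S then 1 else 0

open Classical in
/-- The number of entries of the input matrix `o` in `S`. -/
noncomputable def inputCount (o : Operand) {t : ℕ} (S : Set (alg.Vertex t)) : ℕ :=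
  ∑ x : Fin t → o.Idx m n p, if Sum.inl ⟨o, x⟩ ∈ S then 1 else 0

/-- An edge of the encoding graphs of `o` to `g` leaves `S` or enters it. -/
def IsCut (o : Operand) {t : ℕ} (S : Set (alg.Vertex t)) (g : alg.Gate t) : Prop :=
  ∃ u, alg.IsEncOperand o g u ∧ ¬ (u ∈ S ↔ Sum.inr g ∈ S)

open Classical in
/-- The number of operations with an edge of the encoding graphs of `o` that leaves or enters `S`. -/
noncomputable def cutCount (o : Operand) {t : ℕ} (S : Set (alg.Vertex t)) : ℕ :=
  ∑ g : alg.Gate t, if alg.IsCut o S g then 1 else 0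

theorem mulCount_succ {t : ℕ} (S : Set (alg.Vertex (t + 1))) :
    alg.mulCount S = ∑ r, alg.mulCount (alg.callV r ⁻¹' S) := by
  classical
  rw [mulCount, sum_gate_succ, Finset.sum_eq_zero fun o _ => Finset.sum_eq_zero fun g _ =>
      Finset.sum_eq_zero fun y _ => if_neg fun h => h.1, zero_add]
  rw [Finset.sum_eq_zero (f := fun g => ∑ y, if alg.IsMul (.dec g y : alg.Gate (t + 1)) ∧ _ then 1 else 0)
      fun g _ => Finset.sum_eq_zero fun y _ => if_neg fun h => h.1, add_zero]
  rfl

theorem mulCount_univ : ∀ t, alg.mulCount (Set.univ : Set (alg.Vertex t)) = q ^ t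
  | 0 => by
    rw [mulCount, sum_gate_zero]
    simp [IsMul]
  | t + 1 => by
    rw [mulCount_succ]
    simp only [Set.preimage_univ, mulCount_univ t]
    simp [pow_succ']

theorem mulCount_le {t : ℕ} (S : Set (alg.Vertex t)) : alg.mulCount S ≤ q ^ t := by
  classical
  rw [← mulCount_univ]
  unfold mulCount
  gcongr with g _
  split_ifs <;> simp_all

theorem inputCount_le {o : Operand} {t : ℕ} (S : Set (alg.Vertex t)) :
    alg.inputCount o S ≤ o.card m n p ^ t := by
  classical
  rw [inputCount, Finset.sum_boole, Nat.cast_id]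
  refine (Finset.card_le_univ _).trans ?_
  simp [← Operand.card_idx]

theorem inputCount_succ {o : Operand} {t : ℕ} (S : Set (alg.Vertex (t + 1))) :
    alg.inputCount o S = ∑ x : Fin t → o.Idx m n p, ∑ j : o.Idx m n p,
      open Classical in if alg.encV o x (Sum.inl j) ∈ S then 1 else 0 := by
  classical
  rw [inputCount, ← (Fin.consEquiv fun _ => o.Idx m n p).sum_comp, Fintype.sum_prod_type,
    Finset.sum_comm]
  rfl

theorem inputCount_call {o : Operand} {t : ℕ} (S : Set (alg.Vertex (t + 1))) (r : Fin q) :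
    alg.inputCount o (alg.callV r ⁻¹' S) = ∑ x : Fin t → o.Idx m n p,
      open Classical in if alg.encV o x ((alg.enc o).out r) ∈ S then 1 else 0 := rfl

/-- Cuts are counted by the operation at the head of the edge. Vertices may be shared between calls
and levels, but operations are not, so the counts add up. -/
theorem cutCount_succ_le {o : Operand} {t : ℕ} (S : Set (alg.Vertex (t + 1))) :
    (∑ x, ∑ g, open Classical in if alg.IsCut o S (.enc o g x) then 1 else 0) +
      ∑ r, alg.cutCount o (alg.callV r ⁻¹' S) ≤ alg.cutCount o S := by
  classical
  have h1 : (∑ x, ∑ g, if alg.IsCut o S (.enc o g x) then 1 else 0) ≤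
      ∑ o', ∑ g, ∑ x, if alg.IsCut o S (.enc o' g x) then 1 else 0 := by
    rw [Finset.sum_comm]
    exact Finset.single_le_sum (f := fun o' => ∑ g, ∑ x, if alg.IsCut o S (.enc o' g x) then 1 else 0)
      (fun _ _ => Nat.zero_le _) (Finset.mem_univ o)
  have h2 : ∑ r, alg.cutCount o (alg.callV r ⁻¹' S) ≤
      ∑ r, ∑ g, if alg.IsCut o S (.call r g) then 1 else 0 := by
    unfold cutCount
    gcongr with r _ g _
    by_cases h : alg.IsCut o (alg.callV r ⁻¹' S) g
    · obtain ⟨u, hu, hS⟩ := id h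
      have : alg.IsCut o S (.call r g) := ⟨alg.callV r u, by rw [IsEncOperand]; exact ⟨u, hu, rfl⟩, hS⟩
      rw [if_pos h, if_pos this]
    · rw [if_neg h]
      exact Nat.zero_le _
  rw [cutCount, sum_gate_succ]
  omega

open Classical in
/-- In each copy of the encoding graph either all vertices are in `S`, or none, or there is an edge
that leaves `S`. -/
theorem enc_const_or_cut {o : Operand} (hconn : (alg.enc o).graph.Connected) {t : ℕ}
    (S : Set (alg.Vertex (t + 1))) (x : Fin t → o.Idx m n p) :
    (∀ u v, alg.encV o x u ∈ S ↔ alg.encV o x v ∈ S) ∨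
      1 ≤ ∑ g, if alg.IsCut o S (.enc o g x) then 1 else 0 := by
  by_cases h : ∃ g, alg.IsCut o S (.enc o g x)
  · obtain ⟨g, hg⟩ := h
    right
    calc 1 = if alg.IsCut o S (.enc o g x) then 1 else 0 := by rw [if_pos hg]
      _ ≤ _ := Finset.single_le_sum (f := fun g => if alg.IsCut o S (.enc o g x) then 1 else 0)
        (fun _ _ => Nat.zero_le _) (Finset.mem_univ g)
  · left
    refine (alg.enc o).mem_iff_mem hconn (S := alg.encV o x ⁻¹' S) fun g => ⟨?_, ?_⟩
    · by_contra hS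
      exact h ⟨g, _, ⟨rfl, .inl rfl⟩, hS⟩
    · by_contra hS
      exact h ⟨g, _, ⟨rfl, .inr rfl⟩, hS⟩

/-- The fraction of the entries of `o` in `S` changes little from the input matrix to those of the
recursive calls if there are few cut edges on the outermost level. -/
theorem abs_inputCount_sub_le {o : Operand} (hconn : (alg.enc o).graph.Connected) {t : ℕ}
    (S : Set (alg.Vertex (t + 1))) (r : Fin q) :
    |(o.card m n p : ℝ) * alg.inputCount o (alg.callV r ⁻¹' S) - alg.inputCount o S| ≤
      o.card m n p * (∑ x, ∑ g, open Classical in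
        if alg.IsCut o S (.enc o g x) then 1 else 0 : ℕ) := by
  classical
  rw [inputCount_succ, inputCount_call]
  push_cast
  rw [Finset.mul_sum, ← Finset.sum_sub_distrib, Finset.mul_sum]
  refine (Finset.abs_sum_le_sum_abs _ _).trans (Finset.sum_le_sum fun x _ => ?_)
  -- The contribution of an uncut copy vanishes; that of a cut copy is at most `N`.
  rcases alg.enc_const_or_cut hconn S x with h | h
  · rw [Finset.sum_congr rfl fun j _ => if_congr (h (Sum.inl j) ((alg.enc o).out r)) rfl rfl]
    rw [Finset.sum_const, Finset.card_univ, Operand.card_idx, nsmul_eq_mul, sub_self, abs_zero]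
    positivity
  · have h' : (1 : ℝ) ≤ ∑ g, if alg.IsCut o S (.enc o g x) then 1 else 0 := by exact_mod_cast h
    have hN : (0 : ℝ) ≤ o.card m n p := Nat.cast_nonneg _
    refine le_trans ?_ (mul_le_mul_of_nonneg_left h' hN)
    have h0 : (0 : ℝ) ≤ ∑ j : o.Idx m n p, if alg.encV o x (Sum.inl j) ∈ S then 1 else 0 := by
      positivity
    have h1 : (∑ j : o.Idx m n p, if alg.encV o x (Sum.inl j) ∈ S then (1 : ℝ) else 0) ≤
        o.card m n p := by
      rw [Finset.sum_boole, ← Operand.card_idx]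
      exact_mod_cast Finset.card_le_univ _
    rw [abs_le]
    split_ifs <;> constructor <;> linarith

/-- Here `μ r`, `i r`, `e r` stand for the multiplications, input entries and cuts in call `r`, and
`b` for the cuts on the outermost level; `T = N ^ t` and `Q = q ^ t`. Replacing `N * i r` by `I`
costs at most `N * b` with total weight `μ r + (Q - μ r) = Q`. The induction hypothesis, multiplied
by `N`, gives `N * N * Q * e r ≤ q * (N * Q * e r)`, which is where `N ≤ q` enters. Then sum over
`r`. -/
theorem expansion_step {q : ℕ} {μ i e : Fin q → ℝ} {N T Q I E b : ℝ} (hN : 1 ≤ N) (hq : N ≤ q)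
    (hQ : 0 ≤ Q) (hμ0 : ∀ r, 0 ≤ μ r) (hμ : ∀ r, μ r ≤ Q) (he : ∀ r, 0 ≤ e r)
    (ih : ∀ r, μ r * (T - i r) + (Q - μ r) * i r ≤ N * Q * e r)
    (hd : ∀ r, |N * i r - I| ≤ N * b) (hE : b + ∑ r, e r ≤ E) :
    (∑ r, μ r) * (N * T - I) + (q * Q - ∑ r, μ r) * I ≤ N * (q * Q) * E := by
  have h1 : ∀ r, μ r * (N * T - I) + (Q - μ r) * I - Q * (N * b) ≤ q * (N * Q * e r) := by
    intro r
    obtain ⟨ha, hb⟩ := abs_le.1 (hd r)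
    have h2 := mul_le_mul_of_nonneg_left (ih r) (by linarith : 0 ≤ N)
    have h3 := mul_le_mul_of_nonneg_right hq (by have := he r; positivity : 0 ≤ N * Q * e r)
    have h4 := mul_le_mul_of_nonneg_left hb (hμ0 r)
    have h5 := mul_le_mul_of_nonneg_left ha (sub_nonneg.2 (hμ r))
    nlinarith
  have h2 := Finset.sum_le_sum fun r (_ : r ∈ Finset.univ) => h1 r
  simp only [Finset.sum_sub_distrib, Finset.sum_add_distrib, ← Finset.sum_mul, ← Finset.mul_sum,
    Finset.sum_const, Finset.card_univ, Fintype.card_fin, nsmul_eq_mul] at h2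
  have h3 := mul_le_mul_of_nonneg_left hE (by positivity : 0 ≤ N * (q * Q))
  nlinarith

/-- Edge expansion of the encoding graphs, for sets with given fractions of the multiplications and
of the input entries. -/
theorem le_cutCount {o : Operand} (hconn : (alg.enc o).graph.Connected)
    (hN : 1 ≤ o.card m n p) (hq : o.card m n p ≤ q) : ∀ {t : ℕ} (S : Set (alg.Vertex t)),
    (alg.mulCount S : ℝ) * (o.card m n p ^ t - alg.inputCount o S) +
      (q ^ t - alg.mulCount S) * alg.inputCount o S ≤ o.card m n p * q ^ t * alg.cutCount o S
  | 0, S => by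
    classical
    have hi : alg.inputCount o S = if Sum.inl ⟨o, Fin.elim0⟩ ∈ S then 1 else 0 := by
      rw [inputCount, Fintype.sum_unique, Subsingleton.elim default Fin.elim0]
    rw [hi, mulCount, cutCount, sum_gate_zero, sum_gate_zero]
    have hN' : (1 : ℝ) ≤ o.card m n p := by exact_mod_cast hN
    by_cases h1 : Sum.inl ⟨o, Fin.elim0⟩ ∈ S <;> by_cases h2 : (Sum.inr .mul : alg.Vertex 0) ∈ S <;>
      simp [IsMul, IsCut, IsEncOperand, h1, h2, hN']
  | t + 1, S => by
    classical
    have ih := fun r => le_cutCount hconn hN hq (alg.callV r ⁻¹' S)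
    have hd := fun r => alg.abs_inputCount_sub_le hconn S r
    have hc := alg.cutCount_succ_le (o := o) S
    have hμ := fun r => alg.mulCount_le (alg.callV r ⁻¹' S)
    rw [mulCount_succ]
    have hc' : ((∑ x, ∑ g, if alg.IsCut o S (.enc o g x) then 1 else 0 : ℕ) : ℝ) +
      ∑ r, (alg.cutCount o (alg.callV r ⁻¹' S) : ℝ) ≤ alg.cutCount o S := by exact_mod_cast hc
    push_cast [pow_succ']
    refine expansion_step (μ := fun r => (alg.mulCount (alg.callV r ⁻¹' S) : ℝ))
      (by exact_mod_cast hN) (by exact_mod_cast hq) (by positivity) (fun r => by positivity)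
      (fun r => by exact_mod_cast hμ r) (fun r => by positivity) ih hd hc'

/-- Expansion of small sets: the cut edges in the innermost `k` levels. -/
theorem mulCount_le_cutCount {o : Operand} (hconn : (alg.enc o).graph.Connected)
    (hN : 1 ≤ o.card m n p) (hq : o.card m n p ≤ q) (k : ℕ) : ∀ (j : ℕ) (S : Set (alg.Vertex (k + j))),
    2 * alg.mulCount S ≤ q ^ k →
      o.card m n p ^ k * alg.mulCount S ≤ o.card m n p * q ^ k * alg.cutCount o S
  | 0, S, hS => by
    have h1 := alg.le_cutCount hconn hN hq S
    have h2 : (alg.inputCount o S : ℝ) ≤ _ := Nat.cast_le.2 (alg.inputCount_le S)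
    have hS' : (2 * alg.mulCount S : ℝ) ≤ q ^ k := by exact_mod_cast hS
    simp only [add_zero] at h1 h2
    push_cast at h2
    have h3 : (0 : ℝ) ≤ alg.inputCount o S := Nat.cast_nonneg _
    -- With `μ` multiplications and `i` inputs in `S`, the separated pairs number `μ * N ^ k + (q ^
    -- k - 2 * μ) * i`, at least `μ * N ^ k` for any `i`.
    have h4 : (o.card m n p ^ k * alg.mulCount S : ℝ) ≤ o.card m n p * q ^ k * alg.cutCount o S := by
      nlinarith
    exact_mod_cast h4
  | j + 1, S, hS => by
    -- The part of `S` in each call is no larger than `S`, and the bound is linear, so it can be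
    -- summed over the calls. Cuts on the outermost level are dropped.
    have ih := fun r => mulCount_le_cutCount hconn hN hq k j (alg.callV r ⁻¹' S)
    have h1 := alg.mulCount_succ (t := k + j) S
    have h2 := (Nat.le_add_left _ _).trans (alg.cutCount_succ_le (o := o) (t := k + j) S)
    have h3 : ∀ r, alg.mulCount (alg.callV r ⁻¹' S) ≤ alg.mulCount S := fun r => by
      rw [h1]
      exact Finset.single_le_sum (f := fun r => alg.mulCount (alg.callV r ⁻¹' S))
        (fun _ _ => Nat.zero_le _) (Finset.mem_univ r)
    calc o.card m n p ^ k * alg.mulCount S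
        = ∑ r, o.card m n p ^ k * alg.mulCount (alg.callV r ⁻¹' S) := by rw [← Finset.mul_sum, ← h1]
      _ ≤ ∑ r, o.card m n p * q ^ k * alg.cutCount o (alg.callV r ⁻¹' S) :=
          Finset.sum_le_sum fun r _ => ih r ((Nat.mul_le_mul_left 2 (h3 r)).trans hS)
      _ ≤ _ := by
          rw [← Finset.mul_sum]
          gcongr

/-! ### From expansion to a lower bound on traffic -/

/-- The cut edges are those at the boundary, and at each vertex there are at most `O(t)` of them. -/
theorem cutCount_le {o : Operand} (hcopy : (alg.enc o).NoMultiplyCopied) {t b : ℕ}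
    (S : Set (alg.Gate t)) (hb : ((alg.cdag t).boundary S).encard ≤ b) :
    alg.cutCount o (Sum.inr '' S) ≤
      ((alg.enc o).size + (q + 1) * ((alg.enc o).size * t + 1)) * b := by
  classical
  have hfin : ((alg.cdag t).boundary S).Finite :=
    Set.finite_of_encard_le_coe hb
  set C : Finset (alg.Gate t) := {g | alg.IsCut o (Sum.inr '' S) g} with hC
  have hcut : alg.cutCount o (Sum.inr '' S) = C.card := by
    rw [cutCount, Finset.sum_boole, Nat.cast_id]
  -- Each cut operation is mapped to the operand of one of its cut edges. The fibres are bounded by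
  -- the degree, and the image lies in the boundary. The value at uncut operations is irrelevant.
  have : ∀ g, ∃ u, alg.IsCut o (Sum.inr '' S) g →
      alg.IsEncOperand o g u ∧ ¬ (u ∈ (Sum.inr '' S : Set (alg.Vertex t)) ↔
        Sum.inr g ∈ (Sum.inr '' S : Set (alg.Vertex t))) := by
    intro g
    by_cases h : alg.IsCut o (Sum.inr '' S) g
    · obtain ⟨u, hu⟩ := h
      exact ⟨u, fun _ => hu⟩
    · exact ⟨Sum.inr g, fun h' => absurd h' h⟩
  choose f hf using this
  have hC' : ∀ g ∈ C, alg.IsCut o (Sum.inr '' S) g := fun g hg => by simpa [hC] using hg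
  rw [hcut]
  refine (Finset.card_le_mul_card_image (f := f) C
    ((alg.enc o).size + (q + 1) * ((alg.enc o).size * t + 1)) ?_).trans ?_
  · intro u _
    refine le_trans ?_ (alg.encDegree_le hcopy u)
    rw [encDegree, Finset.sum_boole, Nat.cast_id]
    refine Finset.card_le_card fun g hg => ?_
    simp only [Finset.mem_filter] at hg ⊢
    exact ⟨Finset.mem_univ g, hg.2 ▸ (hf g (hC' g hg.1)).1⟩
  · gcongr
    have h1 : (C.image f : Set (alg.Vertex t)) ⊆ (alg.cdag t).boundary S := by
      intro u hu
      obtain ⟨g, hg, rfl⟩ := Finset.mem_image.1 (Finset.mem_coe.1 hu)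
      obtain ⟨h1, h2⟩ := hf g (hC' g hg)
      exact ⟨g, h1.isOperand, by rwa [Sum.inr_injective.mem_set_image] at h2⟩
    have h2 := (Set.encard_le_encard h1).trans hb
    rw [Set.encard_coe_eq_coe_finsetCard] at h2
    exact_mod_cast h2

open Classical in
/-- The number of multiplications in a set of operations. -/
noncomputable def gateMulCount {t : ℕ} (S : Set (alg.Gate t)) : ℕ :=
  ∑ g : alg.Gate t, if alg.IsMul g ∧ g ∈ S then 1 else 0

theorem mulCount_image_inr {t : ℕ} (S : Set (alg.Gate t)) :
    alg.mulCount (Sum.inr '' S) = alg.gateMulCount S := by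
  classical
  refine Finset.sum_congr rfl fun g _ => if_congr ?_ rfl rfl
  rw [Sum.inr_injective.mem_set_image]

theorem gateMulCount_empty {t : ℕ} : alg.gateMulCount (∅ : Set (alg.Gate t)) = 0 := by
  simp [gateMulCount]

theorem gateMulCount_univ (t : ℕ) : alg.gateMulCount (Set.univ : Set (alg.Gate t)) = q ^ t := by
  rw [← mulCount_univ, mulCount, gateMulCount]
  refine Finset.sum_congr rfl fun g _ => ?_
  split_ifs <;> simp_all

theorem gateMulCount_insert_le {t : ℕ} (S : Set (alg.Gate t)) (g : alg.Gate t) :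
    alg.gateMulCount (insert g S) ≤ alg.gateMulCount S + 1 := by
  classical
  calc _ ≤ ∑ g', ((if alg.IsMul g' ∧ g' ∈ S then 1 else 0) + if g' = g then 1 else 0) := by
        refine Finset.sum_le_sum fun g' _ => ?_
        by_cases h : g' = g
        · rw [if_pos h]
          split_ifs <;> omega
        · simp [h]
    _ = _ := by
        rw [Finset.sum_add_distrib, gateMulCount]
        simp only [Finset.sum_ite_eq', Finset.mem_univ, if_true]

theorem gateMulCount_eq_add {t : ℕ} {S T : Set (alg.Gate t)} (h : S ⊆ T) :
    alg.gateMulCount T = alg.gateMulCount S + alg.gateMulCount (T \ S) := by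
  rw [gateMulCount, gateMulCount, gateMulCount, ← Finset.sum_add_distrib]
  refine Finset.sum_congr rfl fun g _ => ?_
  have := @h g
  split_ifs with h1 h2 h3 h3 h2 h3 h3 <;> simp_all

/-- Between two states with `q ^ k` multiplications in between at least `M` words are moved. -/
theorem le_of_mulCount_eq {o : Operand} (hconn : (alg.enc o).graph.Connected)
    (hcopy : (alg.enc o).NoMultiplyCopied) (hN : 1 ≤ o.card m n p) (hq : o.card m n p ≤ q)
    (hq2 : 2 ≤ q) {k j M : ℕ}
    (hM : 3 * q * M * ((alg.enc o).size + (q + 1) * ((alg.enc o).size * (k + 1 + j) + 1)) ≤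
      o.card m n p ^ k) {x y z : (alg.cdag (k + 1 + j)).State} {w₀ w w' : ℕ}
    (hx : (alg.cdag (k + 1 + j)).Exec M x w₀) (hxy : CDAG.Reach _ M x y w)
    (hyz : CDAG.Reach _ M y z w') (hz : z.done = Set.univ)
    (hS : alg.gateMulCount (y.done \ x.done) = q ^ k) :
    M ≤ w := by
  have h1 := alg.cutCount_le hcopy (b := 2 * M + w) (y.done \ x.done)
    (by exact_mod_cast CDAG.encard_boundary_le hx hxy hyz hz)
  -- Expansion is used on `k + 1` levels: as `q ≥ 2`, the `q ^ k` multiplications are at most half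
  -- of `q ^ (k + 1)`.
  have h2 := alg.mulCount_le_cutCount hconn hN hq (k + 1) j (Sum.inr '' (y.done \ x.done))
    (by rw [mulCount_image_inr, hS, pow_succ']; gcongr)
  rw [mulCount_image_inr, hS] at h2
  set D := (alg.enc o).size + (q + 1) * ((alg.enc o).size * (k + 1 + j) + 1) with hD
  have hD0 : 0 < D := by positivity
  have hN0 : 0 < o.card m n p := hN
  have h3 : o.card m n p ^ k ≤ q * (D * (2 * M + w)) := by
    have hpos : 0 < o.card m n p * q ^ k := by positivity
    refine Nat.le_of_mul_le_mul_left ?_ hpos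
    calc o.card m n p * q ^ k * o.card m n p ^ k = o.card m n p ^ (k + 1) * q ^ k := by ring
      _ ≤ _ := h2
      _ ≤ o.card m n p * q ^ (k + 1) * (D * (2 * M + w)) := by gcongr
      _ = _ := by ring
  -- The boundary has at least `3 * M` vertices, and fast memory at the two ends accounts for only
  -- `2 * M`.
  have h4 : q * D * (3 * M) ≤ q * D * (2 * M + w) := by
    calc _ = 3 * q * M * D := by ring
      _ ≤ _ := hM.trans h3
      _ = _ := by ring
  have := Nat.le_of_mul_le_mul_left h4 (by positivity)
  omega

/-- The lower bound if `k` of the levels are large enough for the memory. -/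
theorem pow_mul_le_of_hasCost {o : Operand} (hconn : (alg.enc o).graph.Connected)
    (hcopy : (alg.enc o).NoMultiplyCopied) (hN : 1 ≤ o.card m n p) (hq : o.card m n p ≤ q)
    (hq2 : 2 ≤ q) {k j M w : ℕ}
    (hM : 3 * q * M * ((alg.enc o).size + (q + 1) * ((alg.enc o).size * (k + 1 + j) + 1)) ≤
      o.card m n p ^ k) (hw : (alg.cdag (k + 1 + j)).HasCost M w) : q ^ (j + 1) * M ≤ w := by
  classical
  obtain ⟨z, hz, hdone, -⟩ := hw
  -- The `q ^ (k + 1 + j)` multiplications make up `q ^ (j + 1)` segments.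
  refine CDAG.Exec.mul_le (P := q ^ k) (z := z) alg.gateMulCount alg.gateMulCount_empty
    alg.gateMulCount_insert_le (fun x y w₀ w w' hx hxy hyz hS => ?_) (q ^ (j + 1)) z w 0 hz .refl ?_
  · refine alg.le_of_mulCount_eq hconn hcopy hN hq hq2 hM hx hxy hyz hdone ?_
    have := alg.gateMulCount_eq_add hxy.done_subset
    omega
  · rw [hdone, ← pow_add]
    refine le_trans ?_ (alg.gateMulCount_univ _).ge
    exact (congrArg (q ^ ·) (by ring)).le

/-- All inputs have to be read. -/
theorem pow_card_le_of_hasCost {o : Operand} (hconn : (alg.enc o).graph.Connected)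
    (hN1 : 1 < o.card m n p) {t M w : ℕ} (hw : (alg.cdag (t + 1)).HasCost M w) :
    o.card m n p ^ (t + 1) ≤ w := by
  have : Nontrivial (o.Idx m n p) := by
    rw [← Fintype.one_lt_card_iff_nontrivial, Operand.card_idx]
    exact hN1
  let f : (Fin (t + 1) → o.Idx m n p) → Input m n p (t + 1) := fun x => ⟨o, x⟩
  have hf : Function.Injective f := fun x y h => by simpa [f] using h
  have h := hw.encard_le (Set.range f) (by
    rintro _ ⟨x, rfl⟩
    obtain ⟨g, hg⟩ := (alg.enc o).exists_operand hconn (x 0)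
    have e : (Sum.inl (f x) : alg.Vertex (t + 1)) = alg.encV o (Fin.tail x) (Sum.inl (x 0)) := by
      simp [encV, f]
    refine ⟨.enc o g (Fin.tail x), hg.imp (fun h => ?_) (fun h => ?_)⟩
    · exact e.trans (congrArg _ h.symm)
    · exact e.trans (congrArg _ h.symm))
  have hcard : (Set.range f).encard = (o.card m n p ^ (t + 1) : ℕ) := by
    rw [← Set.image_univ, hf.encard_image, Set.encard_univ, ENat.card_eq_coe_fintype_card]
    simp [← Operand.card_idx]
  have h' := hcard.symm.trans_le h
  exact_mod_cast h'

end BilinearAlgorithm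

/-! ### At least as many products as input entries -/

/-- Padding with zero columns and rows makes both factors square, and the first then has a zero
column. The argument replaces rank, over an arbitrary commutative ring. -/
theorem Matrix.det_mul_eq_zero_of_card_lt {R ι κ : Type*} [CommRing R] [Fintype ι] [DecidableEq ι]
    [Fintype κ] [DecidableEq κ] (h : Fintype.card κ < Fintype.card ι)
    (P : Matrix ι κ R) (Q : Matrix κ ι R) : (P * Q).det = 0 := by
  let f := Fintype.card ι - Fintype.card κ
  have hf : 0 < f := by omega
  let e : ι ≃ κ ⊕ Fin f := Fintype.equivOfCardEq (by simp [f]; omega)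
  have h1 : P * Q = (Matrix.fromCols P 0).submatrix id e * (Matrix.fromRows Q 0).submatrix e id := by
    rw [Matrix.submatrix_mul_equiv, Matrix.fromCols_mul_fromRows]
    simp
  rw [h1, Matrix.det_mul, Matrix.det_eq_zero_of_column_eq_zero (e.symm (Sum.inr ⟨0, hf⟩)), zero_mul]
  intro i
  simp

/-- The matrix has entries in `O` and is the identity modulo `I`, so its determinant is `1` modulo a
proper ideal. This treats exact and approximate algorithms alike. -/
theorem Matrix.det_ne_zero_of_eq_one_add {K ι : Type*} [CommRing K] [Fintype ι] [DecidableEq ι]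
    {O : Subring K} {I : Ideal O} (hI : I ≠ ⊤) (A : Matrix ι ι K)
    (hA : ∀ i j, ∃ e ∈ I, A i j = (if i = j then 1 else 0) + (e : K)) : A.det ≠ 0 := by
  choose E hE hAE using hA
  have h1 : A = O.subtype.mapMatrix (1 + Matrix.of E) := by
    ext i j
    by_cases h : i = j <;> simp [hAE, h]
  have h2 : (Ideal.Quotient.mk I).mapMatrix (1 + Matrix.of E) = 1 := by
    ext i j
    have := Ideal.Quotient.eq_zero_iff_mem.2 (hE i j)
    by_cases h : i = j <;> simp_all [Matrix.one_apply]
  have : Nontrivial (O ⧸ I) := Ideal.Quotient.nontrivial_iff.2 hI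
  intro h
  rw [h1, ← RingHom.map_det] at h
  have h3 : (1 + Matrix.of E).det = 0 := O.subtype_injective (h.trans (map_zero _).symm)
  have h4 := congrArg (Ideal.Quotient.mk I) h3
  rw [RingHom.map_det, h2, Matrix.det_one, map_zero] at h4
  exact one_ne_zero h4

namespace BilinearAlgorithm

variable {K : Type*} {m n p q : ℕ} (alg : BilinearAlgorithm K m n p q)

/-- There are at least as many multiplications as entries of each input matrix. -/
theorem card_le [CommRing K] (hm : 0 < m) (hp : 0 < p) {O : Subring K}
    {I : Ideal O} (hI : I ≠ ⊤) (hmul : alg.MultipliesModulo O I) (o : Operand) :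
    o.card m n p ≤ q := by
  by_contra! h
  cases o with
  | A =>
    -- For fixed `k = k' = 0` the tensor, as a matrix with rows `(i, j)` and columns `(i', j')`, is
    -- the identity up to the error, and the `q` products factor it as `P * Q`. For `B`, the row
    -- indices `i = i' = 0` are fixed instead.
    let P : Matrix (Fin m × Fin n) (Fin q) K := .of fun ij r => (alg.enc .A).outForm r ij
    let Q : Matrix (Fin q) (Fin m × Fin n) K := .of fun r ij =>
      alg.dec.outForm (ij.1, ⟨0, hp⟩) r * (alg.enc .B).outForm r (ij.2, ⟨0, hp⟩)
    refine Matrix.det_ne_zero_of_eq_one_add hI (P * Q) ?_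
      (Matrix.det_mul_eq_zero_of_card_lt (by simpa [Operand.card] using h) P Q)
    rintro ⟨i, j⟩ ⟨i', j'⟩
    obtain ⟨e, he, h'⟩ := hmul i j j' ⟨0, hp⟩ i' ⟨0, hp⟩
    refine ⟨e, he, ?_⟩
    simp only [and_true] at h'
    simp only [Prod.mk.injEq, ← h', tensor, Matrix.mul_apply, P, Q, Matrix.of_apply]
    exact Finset.sum_congr rfl fun r _ => by ring
  | B =>
    let P : Matrix (Fin n × Fin p) (Fin q) K := .of fun jk r => (alg.enc .B).outForm r jk
    let Q : Matrix (Fin q) (Fin n × Fin p) K := .of fun r jk =>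
      alg.dec.outForm (⟨0, hm⟩, jk.2) r * (alg.enc .A).outForm r (⟨0, hm⟩, jk.1)
    refine Matrix.det_ne_zero_of_eq_one_add hI (P * Q) ?_
      (Matrix.det_mul_eq_zero_of_card_lt (by simpa [Operand.card] using h) P Q)
    rintro ⟨j', k⟩ ⟨j, k'⟩
    obtain ⟨e, he, h'⟩ := hmul ⟨0, hm⟩ j j' k ⟨0, hm⟩ k'
    refine ⟨e, he, ?_⟩
    simp only [true_and, eq_comm (a := j)] at h'
    simp only [Prod.mk.injEq, ← h', tensor, Matrix.mul_apply, P, Q, Matrix.of_apply]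
    exact Finset.sum_congr rfl fun r _ => by ring

end BilinearAlgorithm

/-! ### Building blocks of schedules -/

namespace CDAG

variable {G : CDAG} {M : ℕ}

theorem Reach.discard_finite {x : G.State} {F L : Set (G.Input ⊕ G.Gate)} {D : Set G.Gate} {w : ℕ}
    (h : Reach G M x ⟨F, L, D⟩ w) {U : Set (G.Input ⊕ G.Gate)} (hU : U.Finite) :
    Reach G M x ⟨F \ U, L, D⟩ w := by
  induction U, hU using Set.Finite.induction_on with
  | empty => simpa using h
  | @insert u U _ _ ih =>
    have := ih.discard u
    rwa [show (F \ U) \ {u} = F \ insert u U by ext; simp; tauto] at this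

theorem Reach.discard_to {x : G.State} {F F' L : Set (G.Input ⊕ G.Gate)} {D : Set G.Gate} {w : ℕ}
    (h : Reach G M x ⟨F, L, D⟩ w) (hF : F.encard ≤ M) (hF' : F' ⊆ F) :
    Reach G M x ⟨F', L, D⟩ w := by
  have := h.discard_finite ((Set.finite_of_encard_le_coe hF).subset (Set.sdiff_subset (t := F')))
  rwa [show F \ (F \ F') = F' by rw [sdiff_sdiff_right_self]; exact inf_eq_right.2 hF'] at this

theorem Reach.read_finite {x : G.State} {F L : Set (G.Input ⊕ G.Gate)} {D : Set G.Gate} {w : ℕ}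
    (h : Reach G M x ⟨F, L, D⟩ w) (U : Finset (G.Input ⊕ G.Gate)) (hU : ↑U ⊆ L)
    (hM : (F ∪ U).encard ≤ M) : Reach G M x ⟨F ∪ U, L, D⟩ (w + U.card) := by
  classical
  induction U using Finset.induction_on with
  | empty => simpa using h
  | @insert u U hu ih =>
    rw [Finset.coe_insert] at hU hM ⊢
    rw [Set.union_insert] at hM ⊢
    have h1 := ih ((Set.subset_insert _ _).trans hU)
      ((Set.encard_le_encard (Set.subset_insert _ _)).trans hM)
    rw [Finset.card_insert_of_notMem hu, ← add_assoc]
    exact h1.read u (hU (Set.mem_insert _ _)) hM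

theorem Reach.write_finite {x : G.State} {F L : Set (G.Input ⊕ G.Gate)} {D : Set G.Gate} {w : ℕ}
    (h : Reach G M x ⟨F, L, D⟩ w) (U : Finset (G.Input ⊕ G.Gate)) (hU : ↑U ⊆ F) :
    Reach G M x ⟨F, L ∪ U, D⟩ (w + U.card) := by
  classical
  induction U using Finset.induction_on with
  | empty => simpa using h
  | @insert u U hu ih =>
    rw [Finset.coe_insert] at hU ⊢
    rw [Set.union_insert, Finset.card_insert_of_notMem hu, ← add_assoc]
    exact (ih ((Set.subset_insert _ _).trans hU)).write u (hU (Set.mem_insert _ _))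

/-- Performing a family of operations inside the fast memory. -/
theorem Reach.compute_family {x : G.State} {F L : Set (G.Input ⊕ G.Gate)} {D : Set G.Gate} {w : ℕ}
    (h : Reach G M x ⟨F, L, D⟩ w) {ι : Type*} (e : ι → G.Gate) (he : Function.Injective e)
    (rank : ι → ℕ) (T : Finset ι) (hD : ∀ i ∈ T, e i ∉ D)
    (hop : ∀ i ∈ T, ∀ u, G.IsOperand u (e i) →
      u ∈ F ∨ ∃ j ∈ T, u = Sum.inr (e j) ∧ rank j < rank i)
    (hM : (F ∪ (fun i => Sum.inr (e i)) '' T).encard ≤ M) :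
    Reach G M x ⟨F ∪ (fun i => Sum.inr (e i)) '' T, L, D ∪ e '' T⟩ w := by
  classical
  -- The operation added last has maximal rank, so no other operation of the family depends on it.
  induction T using Finset.induction_on_max_value rank with
  | empty => simpa using h
  | insert a T ha hmax ih =>
    rw [Finset.coe_insert, Set.image_insert_eq, Set.union_insert] at hM
    rw [Finset.coe_insert, Set.image_insert_eq, Set.image_insert_eq, Set.union_insert,
      Set.union_insert]
    have h1 := ih (fun i hi => hD i (Finset.mem_insert_of_mem hi)) (fun i hi u hu => ?_)
      ((Set.encard_le_encard (Set.subset_insert _ _)).trans hM)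
    · have hmem : ∀ u, G.IsOperand u (e a) → u ∈ F ∪ (fun i => Sum.inr (e i)) '' T := by
        intro u hu
        rcases hop a (Finset.mem_insert_self _ _) u hu with h' | ⟨j, hj, rfl, hr⟩
        · exact .inl h'
        · rcases Finset.mem_insert.1 hj with rfl | hj
          · exact absurd hr (lt_irrefl _)
          · exact .inr ⟨j, hj, rfl⟩
      refine h1.compute (e a) ?_ (hmem _ (.inl rfl)) (hmem _ (.inr rfl)) hM
      rintro (h' | ⟨j, hj, h'⟩)
      · exact hD a (Finset.mem_insert_self _ _) h'
      · exact ha (he h' ▸ hj)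
    · rcases hop i (Finset.mem_insert_of_mem hi) u hu with h' | ⟨j, hj, rfl, hr⟩
      · exact .inl h'
      · rcases Finset.mem_insert.1 hj with rfl | hj
        · exact absurd (hmax i hi) (not_le.2 hr)
        · exact .inr ⟨j, hj, rfl, hr⟩

/-- Performing a family of operations one by one, with the operands read from slow memory. -/
theorem Reach.stream_family (hM : 3 ≤ M) {x : G.State} {L : Set (G.Input ⊕ G.Gate)} {D : Set G.Gate}
    {w : ℕ} (h : Reach G M x ⟨∅, L, D⟩ w) {ι : Type*} (e : ι → G.Gate) (he : Function.Injective e)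
    (rank : ι → ℕ) (T : Finset ι) (hD : ∀ i ∈ T, e i ∉ D)
    (hop : ∀ i ∈ T, ∀ u, G.IsOperand u (e i) →
      u ∈ L ∨ ∃ j ∈ T, u = Sum.inr (e j) ∧ rank j < rank i) :
    Reach G M x ⟨∅, L ∪ (fun i => Sum.inr (e i)) '' T, D ∪ e '' T⟩ (w + 3 * T.card) := by
  classical
  induction T using Finset.induction_on_max_value rank with
  | empty => simpa using h
  | insert a T ha hmax ih =>
    rw [Finset.coe_insert, Set.image_insert_eq, Set.image_insert_eq, Set.union_insert,
      Set.union_insert, Finset.card_insert_of_notMem ha]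
    have h1 := ih (fun i hi => hD i (Finset.mem_insert_of_mem hi)) (fun i hi u hu => ?_)
    · have hmem : ∀ u, G.IsOperand u (e a) → u ∈ L ∪ (fun i => Sum.inr (e i)) '' T := by
        intro u hu
        rcases hop a (Finset.mem_insert_self _ _) u hu with h' | ⟨j, hj, rfl, hr⟩
        · exact .inl h'
        · rcases Finset.mem_insert.1 hj with rfl | hj
          · exact absurd hr (lt_irrefl _)
          · exact .inr ⟨j, hj, rfl⟩
      -- Fast memory holds at most two operands and the result; the cost is two reads and one write.
      have h3 : ∀ u v w : G.Input ⊕ G.Gate, ({u, v, w} : Set _).encard ≤ M := fun u v w => by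
        refine (Set.encard_insert_le _ _).trans ?_
        have : ({v, w} : Set (G.Input ⊕ G.Gate)).encard ≤ 1 + 1 :=
          (Set.encard_insert_le _ _).trans_eq (by rw [Set.encard_singleton])
        calc _ ≤ (1 + 1 + 1 : ℕ∞) := by gcongr
          _ ≤ M := by exact_mod_cast hM
      have h4 := h1.read _ (hmem _ (.inl rfl))
        ((Set.encard_le_encard (by simp)).trans (h3 (G.left (e a)) (G.left (e a)) (G.left (e a))))
      have h5 := h4.read _ (hmem _ (.inr rfl))
        ((Set.encard_le_encard (by simp)).trans (h3 (G.right (e a)) (G.left (e a)) (G.left (e a))))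
      have h6 := h5.compute (e a) (by
          rintro (h' | ⟨j, hj, h'⟩)
          · exact hD a (Finset.mem_insert_self _ _) h'
          · exact ha (he h' ▸ hj)) (by simp) (by simp)
        ((Set.encard_le_encard (by simp)).trans (h3 (Sum.inr (e a)) (G.right (e a)) (G.left (e a))))
      have h7 := (h6.write (Sum.inr (e a)) (by simp)).discard_to
        ((Set.encard_le_encard (by simp)).trans (h3 (Sum.inr (e a)) (G.right (e a)) (G.left (e a))))
        (Set.empty_subset _)
      exact h7
    · rcases hop i (Finset.mem_insert_of_mem hi) u hu with h' | ⟨j, hj, rfl, hr⟩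
      · exact .inl h'
      · rcases Finset.mem_insert.1 hj with rfl | hj
        · exact absurd (hmax i hi) (not_le.2 hr)
        · exact .inr ⟨j, hj, rfl, hr⟩

end CDAG

namespace LinCircuit

variable {K : Type*} {X Y : Type} (c : LinCircuit K X Y)

theorem leftV_lt {g h : Fin c.size} (e : c.leftV g = Sum.inr h) : h < g := by
  unfold leftV at e
  rcases hl : c.left g with x | i <;> simp [hl] at e
  exact e ▸ i.isLt

theorem rightV_lt {g h : Fin c.size} (e : c.rightV g = Sum.inr h) : h < g := by
  unfold rightV at e
  rcases hl : c.right g with x | i <;> simp [hl] at e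
  exact e ▸ i.isLt

end LinCircuit

/-! ### The recursive schedule -/

namespace BilinearAlgorithm

variable {K : Type*} {m n p q : ℕ} (alg : BilinearAlgorithm K m n p q)

/-- An occurrence of the `t`-level algorithm as a recursive call in a computation graph. -/
structure Occurrence (G : CDAG) (t : ℕ) where
  vertex : alg.Vertex t → G.Input ⊕ G.Gate
  gate : alg.Gate t → G.Gate
  vertex_inr : ∀ g, vertex (Sum.inr g) = Sum.inr (gate g)
  injective : Function.Injective gate
  left : ∀ g, G.left (gate g) = vertex (alg.leftV g)
  right : ∀ g, G.right (gate g) = vertex (alg.rightV g)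

namespace Occurrence

variable {alg} {G : CDAG} {M t : ℕ}

/-- The computation graph itself. -/
def self (t : ℕ) : alg.Occurrence (alg.cdag t) t where
  vertex := id
  gate := id
  vertex_inr _ := rfl
  injective := Function.injective_id
  left _ := rfl
  right _ := rfl

/-- The `r`-th recursive call. -/
def call (φ : alg.Occurrence G (t + 1)) (r : Fin q) : alg.Occurrence G t where
  vertex v := φ.vertex (alg.callV r v)
  gate g := φ.gate (.call r g)
  vertex_inr g := φ.vertex_inr _
  injective g h e := by simpa using φ.injective e
  left g := φ.left _
  right g := φ.right _

/-- The operations of the outermost encodings. -/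
def encGate (φ : alg.Occurrence G (t + 1)) (e : alg.EncGate t) : G.Gate :=
  φ.gate (.enc e.1 e.2.1 e.2.2)

/-- The operations of the outermost decodings. -/
def decGate (φ : alg.Occurrence G (t + 1)) (e : alg.DecGate t) : G.Gate :=
  φ.gate (.dec e.1 e.2)

theorem encGate_injective (φ : alg.Occurrence G (t + 1)) : Function.Injective φ.encGate := by
  rintro ⟨o, g, x⟩ ⟨o', g', x'⟩ h
  have := φ.injective h
  simp only [Gate.enc.injEq] at this
  obtain ⟨rfl, h1, h2⟩ := this
  simp_all

theorem decGate_injective (φ : alg.Occurrence G (t + 1)) : Function.Injective φ.decGate := by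
  rintro ⟨g, x⟩ ⟨g', x'⟩ h
  have := φ.injective h
  simp only [Gate.dec.injEq] at this
  simp_all

theorem isOperand_encGate (φ : alg.Occurrence G (t + 1)) {e : alg.EncGate t}
    {u : G.Input ⊕ G.Gate} (h : G.IsOperand u (φ.encGate e)) :
    (∃ v, u = φ.vertex (Sum.inl v)) ∨ ∃ e', u = Sum.inr (φ.encGate e') ∧ e'.2.1 < e.2.1.val := by
  obtain ⟨o, g, x⟩ := e
  have key : ∀ v, (∀ g', v = Sum.inr g' → g' < g) → u = φ.vertex (alg.encV o x v) →
      (∃ v, u = φ.vertex (Sum.inl v)) ∨ ∃ e', u = Sum.inr (φ.encGate e') ∧ e'.2.1.val < g.val := by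
    rintro (j | g') hlt hu
    · exact .inl ⟨_, hu⟩
    · exact .inr ⟨⟨o, g', x⟩, hu.trans (φ.vertex_inr _), hlt g' rfl⟩
  rcases h with h | h
  · exact key _ (fun g' => (alg.enc o).leftV_lt) (h.trans (φ.left _))
  · exact key _ (fun g' => (alg.enc o).rightV_lt) (h.trans (φ.right _))

theorem isOperand_decGate (φ : alg.Occurrence G (t + 1)) {e : alg.DecGate t}
    {u : G.Input ⊕ G.Gate} (h : G.IsOperand u (φ.decGate e)) :
    (∃ r y, u = (φ.call r).vertex (alg.outV t y)) ∨
      ∃ e', u = Sum.inr (φ.decGate e') ∧ e'.1 < e.1.val := by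
  obtain ⟨g, y⟩ := e
  have key : ∀ v, (∀ g', v = Sum.inr g' → g' < g) → u = φ.vertex (alg.decV y v) →
      (∃ r y, u = (φ.call r).vertex (alg.outV t y)) ∨
        ∃ e', u = Sum.inr (φ.decGate e') ∧ e'.1.val < g.val := by
    rintro (r | g') hlt hu
    · exact .inl ⟨r, y, hu⟩
    · exact .inr ⟨(g', y), hu.trans (φ.vertex_inr _), hlt g' rfl⟩
  rcases h with h | h
  · exact key _ (fun g' => alg.dec.leftV_lt) (h.trans (φ.left _))
  · exact key _ (fun g' => alg.dec.rightV_lt) (h.trans (φ.right _))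

/-- Once the outermost encodings are done, the inputs of every call are available. Inputs of
different calls may coincide, which is why an `Occurrence` is injective on operations only. -/
theorem vertex_call_inl (φ : alg.Occurrence G (t + 1)) (r : Fin q) (v : Input m n p t) :
    (∃ v', (φ.call r).vertex (Sum.inl v) = φ.vertex (Sum.inl v')) ∨
      ∃ e, (φ.call r).vertex (Sum.inl v) = Sum.inr (φ.encGate e) := by
  obtain ⟨o, x⟩ := v
  change (∃ v', φ.vertex (alg.encV o x ((alg.enc o).out r)) = φ.vertex (Sum.inl v')) ∨
    ∃ e, φ.vertex (alg.encV o x ((alg.enc o).out r)) = Sum.inr (φ.encGate e)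
  rcases (alg.enc o).out r with j | g
  · exact .inl ⟨_, rfl⟩
  · exact .inr ⟨⟨o, g, x⟩, φ.vertex_inr _⟩

theorem vertex_outV (φ : alg.Occurrence G (t + 1)) (y : Fin (t + 1) → Fin m × Fin p) :
    (∃ r y', φ.vertex (alg.outV (t + 1) y) = (φ.call r).vertex (alg.outV t y')) ∨
      ∃ e, φ.vertex (alg.outV (t + 1) y) = Sum.inr (φ.decGate e) := by
  rw [outV]
  rcases alg.dec.out (y 0) with r | g
  · exact .inl ⟨r, _, rfl⟩
  · exact .inr ⟨(g, _), φ.vertex_inr _⟩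

theorem range_gate (φ : alg.Occurrence G (t + 1)) :
    Set.range φ.gate = Set.range φ.encGate ∪ (⋃ r, Set.range (φ.call r).gate) ∪
      Set.range φ.decGate := by
  ext h
  constructor
  · rintro ⟨g, rfl⟩
    cases g with
    | enc o g x => exact .inl (.inl ⟨⟨o, g, x⟩, rfl⟩)
    | call r g => exact .inl (.inr (Set.mem_iUnion.2 ⟨r, g, rfl⟩))
    | dec g y => exact .inr ⟨(g, y), rfl⟩
  · rintro ((⟨e, rfl⟩ | h) | ⟨e, rfl⟩)
    · exact ⟨_, rfl⟩
    · obtain ⟨r, g, rfl⟩ := Set.mem_iUnion.1 h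
      exact ⟨_, rfl⟩
    · exact ⟨_, rfl⟩

/-- The vertices that hold the product. -/
def outputs (φ : alg.Occurrence G t) : Set (G.Input ⊕ G.Gate) :=
  Set.range fun y => φ.vertex (alg.outV t y)

theorem encard_outputs_le (φ : alg.Occurrence G t) : φ.outputs.encard ≤ ((m * p) ^ t : ℕ) := by
  rw [outputs, ← Set.image_univ]
  refine (Set.encard_image_le _ _).trans ?_
  rw [Set.encard_univ, ENat.card_eq_coe_fintype_card]
  simp

theorem encard_range_le {ι α : Type*} [Fintype ι] (f : ι → α) :
    (Set.range f).encard ≤ Fintype.card ι := by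
  rw [← Set.image_univ]
  refine (Set.encard_image_le _ _).trans ?_
  rw [Set.encard_univ, ENat.card_eq_coe_fintype_card]

end Occurrence

/-- An amount of fast memory in which the `t`-level algorithm can be carried out, in addition to
what is needed for its inputs. -/
def space : ℕ → ℕ
  | 0 => 1
  | t + 1 => space t + (Fintype.card (alg.EncGate t) + q * (m * p) ^ t +
      Fintype.card (alg.DecGate t))

/-- The number of words moved if the innermost `k` levels are carried out inside the fast memory. -/
def ioCost (k : ℕ) : ℕ → ℕ
  | 0 => (m * n) ^ k + (n * p) ^ k + (m * p) ^ k
  | j + 1 => 3 * Fintype.card (alg.EncGate (k + j)) + q * ioCost k j +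
      3 * Fintype.card (alg.DecGate (k + j))

end BilinearAlgorithm

theorem Operand.sum_univ {α : Type*} [AddCommMonoid α] (f : Operand → α) :
    ∑ o, f o = f .A + f .B := by
  classical
  have h : (Finset.univ : Finset Operand) = {.A, .B} := by
    ext o
    cases o <;> simp
  rw [h, Finset.sum_pair (by simp)]

namespace BilinearAlgorithm

variable {K : Type*} {m n p q : ℕ} {alg : BilinearAlgorithm K m n p q}

namespace Occurrence

variable {G : CDAG} {M t : ℕ}

/-- Ensures that no operation is performed twice when the calls are run one after another. -/
theorem call_gate_notMem (φ : alg.Occurrence G (t + 1)) (s : Finset (Fin q)) (r : Fin q)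
    (hr : r ∉ s) (g : alg.Gate t) {D : Set G.Gate} (hD : ∀ g, φ.gate g ∉ D) :
    (φ.call r).gate g ∉ D ∪ Set.range φ.encGate ∪ ⋃ r ∈ s, Set.range (φ.call r).gate := by
  rintro ((h | ⟨e, h⟩) | h)
  · exact hD _ h
  · exact absurd (φ.injective h) (by simp)
  · obtain ⟨r', hr', g', h⟩ := Set.mem_iUnion₂.1 h
    have := φ.injective h
    simp only [Gate.call.injEq] at this
    exact hr (this.1 ▸ hr')

theorem decGate_notMem (φ : alg.Occurrence G (t + 1)) (e : alg.DecGate t) {D : Set G.Gate}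
    (hD : ∀ g, φ.gate g ∉ D) :
    φ.decGate e ∉ D ∪ Set.range φ.encGate ∪ ⋃ r, Set.range (φ.call r).gate := by
  rintro ((h | ⟨e', h⟩) | h)
  · exact hD _ h
  · exact absurd (φ.injective h) (by simp)
  · obtain ⟨r', g', h⟩ := Set.mem_iUnion.1 h
    exact absurd (φ.injective h) (by simp)

theorem outputs_subset (φ : alg.Occurrence G (t + 1)) :
    φ.outputs ⊆ (⋃ r, (φ.call r).outputs) ∪ Set.range fun e => Sum.inr (φ.decGate e) := by
  rintro _ ⟨y, rfl⟩
  rcases φ.vertex_outV y with ⟨r, y', h⟩ | ⟨e, h⟩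
  · exact .inl (Set.mem_iUnion.2 ⟨r, y', h.symm⟩)
  · exact .inr ⟨e, h.symm⟩

/-- The whole computation inside the fast memory. -/
theorem run_fast : ∀ {t : ℕ} (φ : alg.Occurrence G t) {x : G.State} {F L : Set (G.Input ⊕ G.Gate)}
    {D : Set G.Gate} {w : ℕ}, CDAG.Reach G M x ⟨F, L, D⟩ w → (∀ v, φ.vertex (Sum.inl v) ∈ F) →
    (∀ g, φ.gate g ∉ D) → F.encard + alg.space t ≤ M →
    CDAG.Reach G M x ⟨F ∪ φ.outputs, L, D ∪ Set.range φ.gate⟩ w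
  | 0, φ, x, F, L, D, w, h, hin, hD, hM => by
    have h1 := h.compute (φ.gate .mul) (hD _) (φ.left .mul ▸ hin _) (φ.right .mul ▸ hin _)
      ((Set.encard_insert_le _ _).trans (by simpa [space] using hM))
    have e1 : φ.outputs = {Sum.inr (φ.gate .mul)} := by
      ext u
      simp [outputs, outV, φ.vertex_inr]
    have e2 : Set.range φ.gate = {φ.gate .mul} := by
      ext u
      constructor
      · rintro ⟨g, rfl⟩
        cases g
        rfl
      · rintro rfl
        exact ⟨_, rfl⟩
    rw [e1, e2, Set.union_singleton, Set.union_singleton]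
    exact h1
  | t + 1, φ, x, F, L, D, w, h, hin, hD, hM => by
    classical
    set E : Set (G.Input ⊕ G.Gate) := Set.range fun e => Sum.inr (φ.encGate e) with hE
    set B : Set (G.Input ⊕ G.Gate) := Set.range fun e => Sum.inr (φ.decGate e) with hB
    have cE : E.encard ≤ Fintype.card (alg.EncGate t) := encard_range_le _
    have cB : B.encard ≤ Fintype.card (alg.DecGate t) := encard_range_le _
    have cU : ∀ s : Finset (Fin q), (⋃ r ∈ s, (φ.call r).outputs).encard ≤ (s.card * (m * p) ^ t : ℕ) := by
      intro s
      induction s using Finset.induction_on with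
      | empty => simp
      | insert r s hr ih =>
        rw [Finset.set_biUnion_insert, Finset.card_insert_of_notMem hr, add_one_mul, add_comm]
        push_cast at ih ⊢
        exact (Set.encard_union_le _ _).trans (add_le_add (by exact_mod_cast encard_outputs_le _) ih)
    rw [space] at hM
    have h1 : CDAG.Reach G M x ⟨F ∪ E, L, D ∪ Set.range φ.encGate⟩ w := by
      have := h.compute_family φ.encGate φ.encGate_injective (fun e => e.2.1.val) Finset.univ
        (fun _ _ => hD _) (fun e _ u hu => ?_) ?_
      · simpa only [Finset.coe_univ, Set.image_univ] using this
      · rcases φ.isOperand_encGate hu with ⟨v, rfl⟩ | ⟨e', he'⟩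
        · exact .inl (hin v)
        · exact .inr ⟨e', Finset.mem_univ _, he'⟩
      · rw [Finset.coe_univ, Set.image_univ]
        refine (Set.encard_union_le _ _).trans (le_trans ?_ hM)
        gcongr
        refine cE.trans ?_
        exact_mod_cast (by omega)
    -- Each finished call leaves only its outputs behind, so the working space `space t` is shared
    -- by all calls.
    have h2 : ∀ s : Finset (Fin q), CDAG.Reach G M x ⟨F ∪ E ∪ ⋃ r ∈ s, (φ.call r).outputs, L,
        D ∪ Set.range φ.encGate ∪ ⋃ r ∈ s, Set.range (φ.call r).gate⟩ w := by
      intro s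
      induction s using Finset.induction_on with
      | empty => simpa using h1
      | insert r s hr ih =>
        have := run_fast (φ.call r) ih (fun v => ?_)
          (fun g => φ.call_gate_notMem s r hr g hD) ?_
        · rw [Finset.set_biUnion_insert, Finset.set_biUnion_insert,
            Set.union_comm (φ.call r).outputs, Set.union_comm (Set.range (φ.call r).gate),
            ← Set.union_assoc, ← Set.union_assoc]
          exact this
        · rcases φ.vertex_call_inl r v with ⟨v', h'⟩ | ⟨e, h'⟩
          · rw [h']; exact .inl (.inl (hin v'))
          · rw [h']; exact .inl (.inr ⟨e, rfl⟩)
        · calc _ ≤ (F.encard + E.encard) + (⋃ r ∈ s, (φ.call r).outputs).encard + alg.space t := by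
                gcongr
                exact (Set.encard_union_le _ _).trans (by gcongr; exact Set.encard_union_le _ _)
            _ ≤ (F.encard + Fintype.card (alg.EncGate t)) + (s.card * (m * p) ^ t : ℕ) +
                alg.space t := by gcongr; exact cU s
            _ ≤ F.encard + (alg.space t + (Fintype.card (alg.EncGate t) + q * (m * p) ^ t +
                Fintype.card (alg.DecGate t)) : ℕ) := by
              rw [add_assoc, add_assoc]
              gcongr
              have := Nat.mul_le_mul_right ((m * p) ^ t)
                ((Finset.card_le_univ s).trans_eq (Fintype.card_fin q))
              exact_mod_cast (by omega)
            _ ≤ M := hM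
    have h3 := h2 Finset.univ
    simp only [Finset.mem_univ, Set.iUnion_true] at h3
    have cF : (F ∪ E ∪ (⋃ r, (φ.call r).outputs) ∪ B).encard ≤ M := by
      have cU' := cU Finset.univ
      simp only [Finset.mem_univ, Set.iUnion_true, Finset.card_univ, Fintype.card_fin] at cU'
      calc _ ≤ (F.encard + E.encard) + (⋃ r, (φ.call r).outputs).encard + B.encard := by
            refine (Set.encard_union_le _ _).trans ?_
            gcongr
            exact (Set.encard_union_le _ _).trans (by gcongr; exact Set.encard_union_le _ _)
        _ ≤ (F.encard + Fintype.card (alg.EncGate t)) + (q * (m * p) ^ t : ℕ) +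
            Fintype.card (alg.DecGate t) := by gcongr
        _ ≤ F.encard + (alg.space t + (Fintype.card (alg.EncGate t) + q * (m * p) ^ t +
                Fintype.card (alg.DecGate t)) : ℕ) := by
          rw [add_assoc, add_assoc]
          gcongr
          exact_mod_cast (by omega)
        _ ≤ M := hM
    have h4 : CDAG.Reach G M x ⟨F ∪ E ∪ (⋃ r, (φ.call r).outputs) ∪ B, L,
        D ∪ Set.range φ.encGate ∪ (⋃ r, Set.range (φ.call r).gate) ∪ Set.range φ.decGate⟩ w := by
      have := h3.compute_family φ.decGate φ.decGate_injective (fun e => e.1.val) Finset.univ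
        (fun e _ => φ.decGate_notMem e hD) (fun e _ u hu => ?_) ?_
      · simpa only [Finset.coe_univ, Set.image_univ] using this
      · rcases φ.isOperand_decGate hu with ⟨r, y, rfl⟩ | ⟨e', he'⟩
        · exact .inl (.inr (Set.mem_iUnion.2 ⟨r, y, rfl⟩))
        · exact .inr ⟨e', Finset.mem_univ _, he'⟩
      · simpa only [Finset.coe_univ, Set.image_univ] using cF
    rw [φ.range_gate, ← Set.union_assoc, ← Set.union_assoc]
    refine h4.discard_to cF (Set.union_subset (fun u hu => .inl (.inl (.inl hu))) ?_)
    refine φ.outputs_subset.trans ?_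
    exact Set.union_subset (fun u hu => .inl (.inr hu)) (fun u hu => .inr hu)

/-- The computation with the innermost `k` levels inside the fast memory. -/
theorem run {k : ℕ} (hM3 : 3 ≤ M) (hM : (m * n) ^ k + (n * p) ^ k + alg.space k ≤ M) :
    ∀ {j : ℕ} (φ : alg.Occurrence G (k + j)) {x : G.State} {L : Set (G.Input ⊕ G.Gate)}
    {D : Set G.Gate} {w : ℕ}, CDAG.Reach G M x ⟨∅, L, D⟩ w → (∀ v, φ.vertex (Sum.inl v) ∈ L) →
    (∀ g, φ.gate g ∉ D) →
    ∃ L' w', L ∪ φ.outputs ⊆ L' ∧ w' ≤ w + alg.ioCost k j ∧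
      CDAG.Reach G M x ⟨∅, L', D ∪ Set.range φ.gate⟩ w'
  | 0, φ, x, L, D, w, h, hin, hD => by
    classical
    have cI : Fintype.card (Input m n p k) = (m * n) ^ k + (n * p) ^ k := by
      rw [Fintype.card_sigma, Operand.sum_univ]
      simp
    let U : Finset (G.Input ⊕ G.Gate) :=
      Finset.univ.image fun v : Input m n p k => φ.vertex (Sum.inl v)
    have hU : U.card ≤ (m * n) ^ k + (n * p) ^ k := by
      rw [← cI]
      exact Finset.card_image_le
    let V : Finset (G.Input ⊕ G.Gate) :=
      Finset.univ.image fun y : Fin k → Fin m × Fin p => φ.vertex (alg.outV k y)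
    have hV : V.card ≤ (m * p) ^ k := by
      refine Finset.card_image_le.trans ?_
      simp
    have hVout : (V : Set (G.Input ⊕ G.Gate)) = φ.outputs := by
      simp [V, outputs]
    have hUe : (∅ ∪ (U : Set (G.Input ⊕ G.Gate))).encard ≤ ((m * n) ^ k + (n * p) ^ k : ℕ) := by
      rw [Set.empty_union, Set.encard_coe_eq_coe_finsetCard]
      exact_mod_cast hU
    have hle : (∅ ∪ (U : Set (G.Input ⊕ G.Gate))).encard + alg.space k ≤ M :=
      (add_le_add_left hUe _).trans (by exact_mod_cast hM)
    have h1 := h.read_finite U (by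
      rintro _ hu
      obtain ⟨v, -, rfl⟩ := Finset.mem_image.1 (Finset.mem_coe.1 hu)
      exact hin v) (le_self_add.trans hle)
    have h2 := run_fast φ h1 (fun v => .inr (Finset.mem_coe.2
      (Finset.mem_image_of_mem _ (Finset.mem_univ v)))) hD hle
    have h3 := h2.write_finite V (hVout ▸ Set.subset_union_right)
    have h4 := h3.discard_finite (U := ∅ ∪ ↑U ∪ φ.outputs)
      ((Set.finite_empty.union U.finite_toSet).union (hVout ▸ V.finite_toSet))
    rw [sdiff_self] at h4
    exact ⟨_, _, hVout ▸ subset_rfl, by rw [ioCost]; omega, h4⟩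
  | j + 1, φ, x, L, D, w, h, hin, hD => by
    classical
    have h1 : CDAG.Reach G M x ⟨∅, L ∪ Set.range fun e => Sum.inr (φ.encGate e),
        D ∪ Set.range φ.encGate⟩ (w + 3 * Fintype.card (alg.EncGate (k + j))) := by
      have := h.stream_family hM3 φ.encGate φ.encGate_injective (fun e => e.2.1.val) Finset.univ
        (fun _ _ => hD _) (fun e _ u hu => ?_)
      · simp only [Finset.coe_univ, Set.image_univ, Finset.card_univ] at this
        exact this
      · rcases φ.isOperand_encGate hu with ⟨v, rfl⟩ | ⟨e', he'⟩
        · exact .inl (hin v)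
        · exact .inr ⟨e', Finset.mem_univ _, he'⟩
    -- Fast memory is empty between calls. Slow memory also collects intermediate values of the
    -- calls, so only a lower bound for its contents is kept.
    have h2 : ∀ s : Finset (Fin q), ∃ L' w', (L ∪ Set.range fun e => Sum.inr (φ.encGate e)) ∪
        (⋃ r ∈ s, (φ.call r).outputs) ⊆ L' ∧
        w' ≤ w + 3 * Fintype.card (alg.EncGate (k + j)) + s.card * alg.ioCost k j ∧
        CDAG.Reach G M x ⟨∅, L',
          D ∪ Set.range φ.encGate ∪ ⋃ r ∈ s, Set.range (φ.call r).gate⟩ w' := by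
      intro s
      induction s using Finset.induction_on with
      | empty =>
        refine ⟨_, _, Set.union_subset subset_rfl (by simp), le_self_add, ?_⟩
        simp only [Finset.notMem_empty, Set.iUnion_of_empty, Set.iUnion_empty, Set.union_empty]
        exact h1
      | insert r s hr ih =>
        obtain ⟨L', w', hL, hw, h'⟩ := ih
        have hin' : ∀ v, (φ.call r).vertex (Sum.inl v) ∈ L' := by
          intro v
          refine hL ?_
          rcases φ.vertex_call_inl r v with ⟨v', h'⟩ | ⟨e, h'⟩
          · rw [h']; exact .inl (.inl (hin v'))
          · rw [h']; exact .inl (.inr ⟨e, rfl⟩)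
        obtain ⟨L'', w'', hL', hw', h''⟩ := run hM3 hM (φ.call r) h' hin'
          (fun g => φ.call_gate_notMem s r hr g hD)
        refine ⟨L'', w'', ?_, ?_, ?_⟩
        · rw [Finset.set_biUnion_insert, Set.union_comm (φ.call r).outputs, ← Set.union_assoc]
          exact (Set.union_subset_union_left _ hL).trans hL'
        · rw [Finset.card_insert_of_notMem hr, add_one_mul]
          omega
        · rw [Finset.set_biUnion_insert, Set.union_comm (Set.range (φ.call r).gate),
            ← Set.union_assoc]
          exact h''
    obtain ⟨L', w', hL, hw, h3⟩ := h2 Finset.univ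
    simp only [Finset.mem_univ, Set.iUnion_true, Finset.card_univ, Fintype.card_fin] at hL hw h3
    have h4 := h3.stream_family hM3 φ.decGate φ.decGate_injective (fun e => e.1.val) Finset.univ
        (fun e _ => φ.decGate_notMem e hD) (fun e _ u hu => ?_)
    · rw [Finset.coe_univ, Set.image_univ, Set.image_univ, Set.union_assoc, Set.union_assoc,
        ← Set.union_assoc (Set.range φ.encGate), ← φ.range_gate] at h4
      refine ⟨_, _, ?_, ?_, h4⟩
      · refine Set.union_subset (fun u hu => .inl (hL (.inl (.inl hu)))) ?_
        refine φ.outputs_subset.trans (Set.union_subset_union_left _ ?_)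
        exact fun u hu => hL (.inr hu)
      · refine (add_le_add hw (Nat.mul_le_mul_left 3
          (le_refl (Fintype.card (alg.DecGate (k + j)))))).trans ?_
        rw [ioCost]
        omega
    · rcases φ.isOperand_decGate hu with ⟨r, y, rfl⟩ | ⟨e', he'⟩
      · exact .inl (hL (.inr (Set.mem_iUnion.2 ⟨r, y, rfl⟩)))
      · exact .inr ⟨e', Finset.mem_univ _, he'⟩

end Occurrence

theorem hasCost_of_le (alg : BilinearAlgorithm K m n p q) {k j M : ℕ} (hM3 : 3 ≤ M)
    (hM : (m * n) ^ k + (n * p) ^ k + alg.space k ≤ M) :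
    ∃ w ≤ alg.ioCost k j, (alg.cdag (k + j)).HasCost M w := by
  obtain ⟨L', w', hL, hw, h⟩ := Occurrence.run hM3 hM (Occurrence.self (alg := alg) (k + j)) (w := 0)
    .refl (fun v => Set.mem_range_self v) (fun g => Set.notMem_empty _)
  refine ⟨w', by omega, _, by simpa using CDAG.Exec.start.of_reach h, ?_, ?_⟩
  · exact Set.range_id
  · exact (Set.subset_union_right).trans hL

end BilinearAlgorithm

/-! ### Estimates of space and cost, and choice of the level -/

namespace BilinearAlgorithm

variable {K : Type*} {m n p q : ℕ} (alg : BilinearAlgorithm K m n p q)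

/-- The number of operations outside of the recursive calls on one level, up to the size of the
matrices. -/
def overhead : ℕ := (alg.enc .A).size + (alg.enc .B).size + q + alg.dec.size + 1

theorem card_encGate_add_le {N : ℕ} (h1 : m * n ≤ N) (h2 : n * p ≤ N) (h3 : m * p ≤ N) (t : ℕ) :
    Fintype.card (alg.EncGate t) + q * (m * p) ^ t + Fintype.card (alg.DecGate t) ≤
      alg.overhead * N ^ t := by
  have hE : Fintype.card (alg.EncGate t) =
      (alg.enc .A).size * (m * n) ^ t + (alg.enc .B).size * (n * p) ^ t := by
    rw [Fintype.card_sigma, Operand.sum_univ]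
    simp
  have hD : Fintype.card (alg.DecGate t) = alg.dec.size * (m * p) ^ t := by
    simp
  rw [hE, hD]
  calc _ ≤ (alg.enc .A).size * N ^ t + (alg.enc .B).size * N ^ t + q * N ^ t +
        alg.dec.size * N ^ t := by gcongr
    _ ≤ _ := by rw [overhead]; nlinarith [Nat.zero_le (N ^ t)]

/-- A geometric sum dominated by the outermost level: `2 * N ^ t ≤ N ^ (t + 1)`. -/
theorem space_le {N : ℕ} (hN : 2 ≤ N) (h1 : m * n ≤ N) (h2 : n * p ≤ N) (h3 : m * p ≤ N) :
    ∀ t, alg.space t ≤ alg.overhead * N ^ t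
  | 0 => by simp [space, overhead]
  | t + 1 => by
    rw [space, pow_succ]
    have := space_le hN h1 h2 h3 t
    have := alg.card_encGate_add_le h1 h2 h3 t
    nlinarith [Nat.zero_le (alg.overhead * N ^ t)]

/-- A geometric sum dominated by the innermost level. The extra term on the left makes the induction
close: multiplied by `q ≥ N + 1`, it pays for the streaming on the new level and for `N` times
itself. -/
theorem ioCost_le {N : ℕ} (hNq : N < q) (h1 : m * n ≤ N) (h2 : n * p ≤ N) (h3 : m * p ≤ N) (k : ℕ) :
    ∀ j, alg.ioCost k j + 3 * alg.overhead * N ^ (k + j) ≤ (3 + 3 * alg.overhead) * (q ^ j * N ^ k)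
  | 0 => by
    have := Nat.pow_le_pow_left h1 k
    have := Nat.pow_le_pow_left h2 k
    have := Nat.pow_le_pow_left h3 k
    rw [ioCost, add_zero, pow_zero, one_mul, add_mul]
    omega
  | j + 1 => by
    have ih := Nat.mul_le_mul_left q (ioCost_le hNq h1 h2 h3 k j)
    have h4 := alg.card_encGate_add_le h1 h2 h3 (k + j)
    have h5 : (N + 1) * (3 * alg.overhead * N ^ (k + j)) ≤ q * (3 * alg.overhead * N ^ (k + j)) :=
      Nat.mul_le_mul_right _ hNq
    have h6 : 3 * alg.overhead * N ^ (k + (j + 1)) = N * (3 * alg.overhead * N ^ (k + j)) := by ring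
    have h7 : (3 + 3 * alg.overhead) * (q ^ (j + 1) * N ^ k) =
        q * ((3 + 3 * alg.overhead) * (q ^ j * N ^ k)) := by ring
    rw [ioCost, h6, h7]
    rw [mul_add] at ih
    rw [add_one_mul] at h5
    have h8 : 3 * alg.overhead * N ^ (k + j) = 3 * (alg.overhead * N ^ (k + j)) := by ring
    have := Nat.zero_le (q * (m * p) ^ (k + j))
    omega

/-- A choice of how many levels to keep in fast memory. The exceptions are a memory too small for
the estimate even at `k = 0`, and one that holds the whole problem. -/
theorem exists_level {a N M : ℕ} : ∀ t, ∃ k ≤ t, (k = 0 ∨ a * N ^ k ≤ M) ∧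
    (k = t ∨ M ≤ a * N ^ (k + 1))
  | 0 => ⟨0, le_rfl, .inl rfl, .inl rfl⟩
  | t + 1 => by
    obtain ⟨k, hk, h1, rfl | h2⟩ := exists_level (a := a) (N := N) (M := M) t
    · by_cases h : a * N ^ (k + 1) ≤ M
      · exact ⟨k + 1, le_rfl, .inr h, .inl rfl⟩
      · exact ⟨k, hk.trans (Nat.le_succ _), h1, .inr (not_le.1 h).le⟩
    · exact ⟨k, hk.trans (Nat.le_succ _), h1, .inr h2⟩

/-- With `ω = log_N q`, `q ^ k = (N ^ k) ^ ω`, so the cost `q ^ j * N ^ k` equals `q ^ t / (N ^ k) ^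
(ω - 1)`, and `N ^ k` is at least a constant times `M`. -/
theorem exists_hasCost_le {N : ℕ} (hN : 2 ≤ N) (hNq : N < q) (h1 : m * n ≤ N) (h2 : n * p ≤ N)
    (h3 : m * p ≤ N) {κ : ℝ} (hκ : 0 < κ) {t M : ℕ} (hM : 3 ≤ M) (hMκ : (M : ℝ) ≤ κ * (N : ℝ) ^ t) :
    ∃ w : ℕ, (alg.cdag t).HasCost M w ∧ (w : ℝ) ≤
      ((3 + 3 * alg.overhead : ℕ) * (κ + ((2 + alg.overhead) * N : ℕ)) ^ (Real.logb N q - 1)) *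
        ((q : ℝ) ^ t / (M : ℝ) ^ (Real.logb N q - 1)) := by
  obtain ⟨k, hk, hk1, hk2⟩ := exists_level (a := 2 + alg.overhead) (N := N) (M := M) t
  obtain ⟨j, rfl⟩ := Nat.exists_eq_add_of_le hk
  have hfit : (m * n) ^ k + (n * p) ^ k + alg.space k ≤ M := by
    rcases hk1 with rfl | hk1
    -- One scalar multiplication needs two operands and a result: three words.
    · simpa [space] using hM
    · have := Nat.pow_le_pow_left h1 k
      have := Nat.pow_le_pow_left h2 k
      have := alg.space_le hN h1 h2 h3 k
      rw [add_mul] at hk1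
      omega
  obtain ⟨w, hw, hcost⟩ := alg.hasCost_of_le (j := j) hM hfit
  refine ⟨w, hcost, ?_⟩
  set ω := Real.logb N q with hω
  have hN1 : (1 : ℝ) < N := by exact_mod_cast hN
  have hN0 : (0 : ℝ) < N := by linarith
  have hq0 : (0 : ℝ) < q := by exact_mod_cast (by omega : 0 < q)
  have hω1 : 1 ≤ ω := by
    rw [hω, Real.le_logb_iff_rpow_le hN1 hq0, Real.rpow_one]
    exact_mod_cast hNq.le
  have hqN : (N : ℝ) ^ ω = q := Real.rpow_logb hN0 hN1.ne' hq0
  have hM0 : (0 : ℝ) < M := by exact_mod_cast (by omega : 0 < M)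
  have hMk : (M : ℝ) ≤ (κ + ((2 + alg.overhead) * N : ℕ)) * (N : ℝ) ^ k := by
    -- If all levels are kept in fast memory, the assumption `M ≤ κ * N ^ t` is what bounds `M` by a
    -- multiple of `N ^ k`.
    rcases hk2 with hk2 | hk2
    · have : j = 0 := by omega
      subst this
      refine hMκ.trans ?_
      rw [add_zero]
      gcongr
      simp only [le_add_iff_nonneg_right]
      positivity
    · calc (M : ℝ) ≤ ((2 + alg.overhead) * N ^ (k + 1) : ℕ) := by exact_mod_cast hk2
        _ = ((2 + alg.overhead) * N : ℕ) * (N : ℝ) ^ k := by push_cast; ring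
        _ ≤ _ := by
          gcongr
          linarith
  have hw' : (w : ℝ) ≤ (3 + 3 * alg.overhead : ℕ) * ((q : ℝ) ^ j * (N : ℝ) ^ k) := by
    have := alg.ioCost_le hNq h1 h2 h3 k j
    exact_mod_cast (by omega : w ≤ (3 + 3 * alg.overhead) * (q ^ j * N ^ k))
  refine hw'.trans ?_
  rw [mul_assoc]
  refine mul_le_mul_of_nonneg_left ?_ (Nat.cast_nonneg _)
  rw [mul_div_assoc', le_div_iff₀ (by positivity)]
  have hk3 : (q : ℝ) ^ k = ((N : ℝ) ^ k) ^ ω := by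
    rw [← hqN, ← Real.rpow_natCast, ← Real.rpow_natCast, ← Real.rpow_mul hN0.le,
      ← Real.rpow_mul hN0.le, mul_comm]
  have hNk : (0 : ℝ) < (N : ℝ) ^ k := by positivity
  calc (q : ℝ) ^ j * (N : ℝ) ^ k * (M : ℝ) ^ (ω - 1)
      ≤ (q : ℝ) ^ j * (N : ℝ) ^ k *
        ((κ + ((2 + alg.overhead) * N : ℕ)) * (N : ℝ) ^ k) ^ (ω - 1) := by
        gcongr
    _ = (κ + ((2 + alg.overhead) * N : ℕ)) ^ (ω - 1) *
        ((q : ℝ) ^ j * ((N : ℝ) ^ k * ((N : ℝ) ^ k) ^ (ω - 1))) := by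
        rw [Real.mul_rpow (by positivity) hNk.le]
        ring
    _ = (κ + ((2 + alg.overhead) * N : ℕ)) ^ (ω - 1) * ((q : ℝ) ^ (k + j)) := by
        rw [← Real.rpow_one_add' hNk.le (by linarith), add_sub_cancel, ← hk3]
        ring

/-- For the least `k` with `A * t * M ≤ N ^ k` one has `N ^ k ≤ N * A * t * M`, hence `q ^ k ≤ (N *
A * t * M) ^ ω`. If `k < t`, the segments give the bound; otherwise the inputs alone do. -/
theorem div_le_of_hasCost {o : Operand} (hconn : (alg.enc o).graph.Connected)
    (hcopy : (alg.enc o).NoMultiplyCopied) (hN : 1 < o.card m n p) (hNq : o.card m n p ≤ q)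
    {t M w : ℕ} (ht : 1 ≤ t) (hM : 1 ≤ M) (hw : (alg.cdag t).HasCost M w) :
    (q : ℝ) ^ t * M / ((o.card m n p * (3 * q * ((alg.enc o).size + (q + 1) *
      ((alg.enc o).size + 1))) * t * M : ℕ) : ℝ) ^ Real.logb (o.card m n p) q ≤ w := by
  set A := 3 * q * ((alg.enc o).size + (q + 1) * ((alg.enc o).size + 1)) with hA
  set N := o.card m n p with hNdef
  set ω := Real.logb N q with hω
  have hA0 : 0 < A := by
    have : 0 < q := by omega
    positivity
  have hq0' : 0 < q := by omega
  have hN1 : (1 : ℝ) < N := by exact_mod_cast hN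
  have hN0 : (0 : ℝ) < N := by linarith
  have hq0 : (0 : ℝ) < q := by exact_mod_cast hq0'
  have hω1 : 1 ≤ ω := by
    rw [hω, Real.le_logb_iff_rpow_le hN1 hq0, Real.rpow_one]
    exact_mod_cast hNq
  have hqN : (N : ℝ) ^ ω = q := Real.rpow_logb hN0 hN1.ne' hq0
  have hpow : ∀ k : ℕ, (q : ℝ) ^ k = ((N : ℝ) ^ k) ^ ω := fun k => by
    rw [← hqN, ← Real.rpow_natCast, ← Real.rpow_natCast, ← Real.rpow_mul hN0.le,
      ← Real.rpow_mul hN0.le, mul_comm]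
  have hX : (0 : ℝ) < (N * A * t * M : ℕ) := by
    have : 0 < N * A * t * M := by positivity
    exact_mod_cast this
  have hM0 : (0 : ℝ) < M := by exact_mod_cast hM
  have hex : ∃ k, A * t * M ≤ N ^ k := ⟨A * t * M, (Nat.lt_pow_self hN).le⟩
  obtain ⟨k, hk, hmin⟩ : ∃ k, A * t * M ≤ N ^ k ∧ N ^ k ≤ N * A * t * M := by
    refine ⟨Nat.find hex, Nat.find_spec hex, ?_⟩
    rcases h : Nat.find hex with _ | k
    · rw [pow_zero]
      exact Nat.one_le_iff_ne_zero.2 (by positivity)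
    · have h1 := Nat.find_min hex (m := k) (by omega)
      rw [pow_succ']
      calc N * N ^ k ≤ N * (A * t * M) := by gcongr; exact (not_le.1 h1).le
        _ = _ := by ring
  have hk' : (N : ℝ) ^ k ≤ (N * A * t * M : ℕ) := by exact_mod_cast hmin
  by_cases hkt : k + 1 ≤ t
  · obtain ⟨j, rfl⟩ := Nat.exists_eq_add_of_le hkt
    have h1 := alg.pow_mul_le_of_hasCost hconn hcopy hN.le hNq (hN.trans_le hNq) (k := k) (j := j)
      (M := M) ?_ hw
    · have h2 : (q : ℝ) ^ k ≤ ((N * A * (k + 1 + j) * M : ℕ) : ℝ) ^ ω := by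
        rw [hpow]
        gcongr
      have h3 : ((q ^ (j + 1) * M : ℕ) : ℝ) ≤ w := by exact_mod_cast h1
      refine le_trans ?_ h3
      rw [div_le_iff₀ (by positivity)]
      calc (q : ℝ) ^ (k + 1 + j) * M = (q : ℝ) ^ (j + 1) * M * q ^ k := by ring
        _ ≤ _ := by
          push_cast at h2 ⊢
          gcongr
    · refine le_trans ?_ hk
      have ht' : 1 ≤ k + 1 + j := ht
      generalize k + 1 + j = t at ht' ⊢
      rw [hA]
      -- As `t ≥ 1`, the degree bound is at most a constant times `t`.
      have : (alg.enc o).size + (q + 1) * ((alg.enc o).size * t + 1) ≤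
          ((alg.enc o).size + (q + 1) * ((alg.enc o).size + 1)) * t := by
        calc _ ≤ (alg.enc o).size * t + (q + 1) * ((alg.enc o).size * t + t) := by
              gcongr
              exact Nat.le_mul_of_pos_right _ ht'
          _ = _ := by ring
      calc _ ≤ 3 * q * M * (((alg.enc o).size + (q + 1) * ((alg.enc o).size + 1)) * t) := by gcongr
        _ = _ := by ring
  -- Here `N ^ t` is at most `X = N * A * t * M`, so `(N ^ t / X) ^ ω ≤ N ^ t / X`; as `M ≤ X`, the
  -- claimed bound is at most the number `N ^ t` of inputs.
  · obtain ⟨t, rfl⟩ := Nat.exists_eq_add_of_le' ht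
    have h1 : ((N ^ (t + 1) : ℕ) : ℝ) ≤ w := by
      exact_mod_cast alg.pow_card_le_of_hasCost hconn hN hw
    refine le_trans ?_ h1
    have h2 : (N : ℝ) ^ (t + 1) ≤ (N * A * (t + 1) * M : ℕ) :=
      (pow_le_pow_right₀ hN1.le (by omega)).trans hk'
    rw [hpow, mul_div_right_comm, ← Real.div_rpow (by positivity) hX.le]
    calc _ ≤ (N : ℝ) ^ (t + 1) / (N * A * (t + 1) * M : ℕ) * M := by
          gcongr
          exact Real.rpow_le_self_of_le_one (by positivity) (div_le_one_of_le₀ h2 hX.le) hω1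
      _ ≤ _ := by
          rw [div_mul_eq_mul_div, div_le_iff₀ hX]
          push_cast
          gcongr
          have : 1 ≤ N * A * (t + 1) := Nat.one_le_iff_ne_zero.2 (by positivity)
          have : (1 : ℝ) ≤ N * A * (t + 1) := by exact_mod_cast this
          nlinarith

end BilinearAlgorithm

/-! ### The theorem -/

theorem theorem2 {K : Type*} [CommRing K] (m n p q : ℕ) (hm : 0 < m) (hn : 0 < n) (hp : 0 < p)
    (alg : BilinearAlgorithm K m n p q)
    (O : Subring K) (I : Ideal O) (hI : I ≠ ⊤) (hmul : alg.MultipliesModulo O I)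
    (o : Operand) (N : ℕ) (hN : N = o.card m n p) (hN1 : 1 < N)
    (hconn : (alg.enc o).graph.Connected) (hcopy : (alg.enc o).NoMultiplyCopied) :
    (∃ c : ℝ, 0 < c ∧ ∀ t M w : ℕ, 1 ≤ t → 1 ≤ M → (alg.cdag t).HasCost M w →
      c * ((q : ℝ) ^ t /
        ((t : ℝ) ^ Real.logb N q * (M : ℝ) ^ (Real.logb N q - 1))) ≤ (w : ℝ)) ∧
    (N = max (m * n) (max (n * p) (m * p)) → N < q →
      ∀ κ : ℝ, 0 < κ → ∃ C : ℝ, 0 < C ∧ ∀ t M : ℕ, 1 ≤ t → 3 ≤ M → (M : ℝ) ≤ κ * (N : ℝ) ^ t →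
        ∃ w : ℕ, (alg.cdag t).HasCost M w ∧
          (w : ℝ) ≤ C * ((t : ℝ) ^ Real.logb N q * ((q : ℝ) ^ t /
            ((t : ℝ) ^ Real.logb N q * (M : ℝ) ^ (Real.logb N q - 1))))) ∧
    (∀ t : ℕ, 1 ≤ t → (t : ℝ) ^ Real.logb N q ≤
      Real.logb 2 (((m * n) ^ t + (n * p) ^ t : ℕ) : ℝ) ^ Real.logb N q) := by
  have hNq : N ≤ q := hN ▸ alg.card_le hm hp hI hmul o
  have hN1' : (1 : ℝ) < N := by exact_mod_cast hN1
  refine ⟨?_, ?_, ?_⟩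
  · set A := N * (3 * q * ((alg.enc o).size + (q + 1) * ((alg.enc o).size + 1))) with hA
    have hA0 : (0 : ℝ) < A := by
      have hq0 : 0 < q := by omega
      have : 0 < A := by positivity
      exact_mod_cast this
    refine ⟨((A : ℝ) ^ Real.logb N q)⁻¹, by positivity, fun t M w ht hM hw => ?_⟩
    have h := alg.div_le_of_hasCost hconn hcopy (hN ▸ hN1) (hN ▸ hNq) ht hM hw
    rw [← hN, ← hA] at h
    refine le_trans (le_of_eq ?_) h
    have hM0 : (0 : ℝ) < M := by exact_mod_cast hM
    have ht0 : (0 : ℝ) < t := by exact_mod_cast ht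
    push_cast
    rw [Real.mul_rpow (by positivity) hM0.le, Real.mul_rpow hA0.le ht0.le, Real.rpow_sub_one hM0.ne']
    field_simp
  · intro hmax hNq' κ hκ
    have h1 : m * n ≤ N := hmax ▸ le_max_left _ _
    have h2 : n * p ≤ N := hmax ▸ (le_max_left _ _).trans (le_max_right _ _)
    have h3 : m * p ≤ N := hmax ▸ (le_max_right _ _).trans (le_max_right _ _)
    refine ⟨(3 + 3 * alg.overhead : ℕ) *
      (κ + ((2 + alg.overhead) * N : ℕ)) ^ (Real.logb N q - 1), by positivity,
      fun t M ht hM hMκ => ?_⟩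
    obtain ⟨w, hw, hle⟩ := alg.exists_hasCost_le hN1 hNq' h1 h2 h3 hκ hM hMκ
    refine ⟨w, hw, hle.trans_eq ?_⟩
    have ht0 : (0 : ℝ) < t := by exact_mod_cast ht
    congr 1
    have : (t : ℝ) ^ Real.logb N q ≠ 0 := by positivity
    field_simp
  · intro t ht
    refine Real.rpow_le_rpow (by positivity) ?_ (Real.logb_nonneg hN1' ?_)
    -- The matrix `o` alone has `N ^ t ≥ 2 ^ t` entries.
    · have h2 : 2 ^ t ≤ (m * n) ^ t + (n * p) ^ t := by
        cases o with
        | A => exact (Nat.pow_le_pow_left (hN1.trans_eq hN : 1 < m * n) t).trans (Nat.le_add_right _ _)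
        | B => exact (Nat.pow_le_pow_left (hN1.trans_eq hN : 1 < n * p) t).trans (Nat.le_add_left _ _)
      have h3 : (2 : ℝ) ^ (t : ℝ) ≤ ((m * n) ^ t + (n * p) ^ t : ℕ) := by
        rw [Real.rpow_natCast]
        exact_mod_cast h2
      exact (Real.le_logb_iff_rpow_le one_lt_two (lt_of_lt_of_le (by positivity) h3)).2 h3
    · exact_mod_cast hN1.le.trans hNq
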